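/- Let $d\ge 1$. An environment is a family $\omega=(\omega_x)_{x\in\mathbb Z^d}$ of probability vectors $\omega_x=(\omega_{x,z})_{z\in\mathbb Z^d}$ on $\mathbb Z^d$, and $\pi_{x,y}(\omega)=\omega_{x,y-x}$. Let $P_x^\omega$ be the law of the Markov chain $(X_n)_{n\ge0}$ on $\mathbb Z^d$ started at $x$ with transition probabilities $\pi_{x,y}(\omega)$. Let $\mathbb P$ be an i.i.d. product measure on environments, that is, the vectors $\omega_x$, $x\in\mathbb Z^d$, are i.i.d. under $\mathbb P$; let $\mathbb E$ be its expectation, and let $P_0=\int P_0^\omega\,\mathbb P(d\omega)$ and $P_{0,0}=\int P_0^\omega\otimes P_0^\omega\,\mathbb P(d\omega)$ be the averaged laws of one walk $X$ and of two independent walks $X,\widetilde X$ in a common environment, all started at $0$. Expectations are denoted $E_0^\omega$, $E_0$, $E_{0,0}$. Fix $\hat u\in\mathbb Z^d$ with $P_0\{X_n\cdot\hat u\to\infty\}=1$, and let $\tau_1$ be the first time $t\ge1$ such that $$\sup_{n<t}X_n\cdot\hat u<X_t\cdot\hat u=\inf_{n\ge t}X_n\cdot\hat u$$ ($\tau_1=\infty$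 if there is none). Suppose that (T) $E_0(\tau_1^{p_0})<\infty$ for a real number $p_0$ (whose size is restricted below); (S) there is a finite deterministic constant $M>0$ such that $\mathbb P\{\pi_{0,z}=0\}=1$ whenever $|z|>M$, where $|\cdot|$ is the Euclidean norm. Write $X_{[0,n)}=\{X_k:0\le k<n\}$ and assume that there is an $\bar\alpha<1/2$ such that, as $n\to\infty$, $$E_{0,0}\bigl[\,|X_{[0,n)}\cap\widetilde X_{[0,n)}|\,\bigr]=O(n^{2\bar\alpha}).$$ Let $\alpha\in(\bar\alpha,1/2)$ and assume $p_0>\dfrac{22d}{\alpha-\bar\alpha}$. Then, as $n\to\infty$, $$\mathbb E\bigl[\,|E_0^\omega(X_n)-E_0(X_n)|^2\,\bigr]=O(n^{2\alpha}).$$ -/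

import Mathlib

open MeasureTheory ProbabilityTheory Filter
open scoped ENNReal

noncomputable section

namespace RWRE

/-- The lattice `ℤ^d`, with its discrete `σ`-algebra. -/
abbrev Site (d : ℕ) : Type := Fin d → ℤ

/-- A site viewed as a vector of Euclidean space `ℝ^d`. -/
def toE {d : ℕ} (x : Site d) : EuclideanSpace ℝ (Fin d) :=
  WithLp.toLp 2 fun i => (x i : ℝ)

/-- Probability vectors on `ℤ^d` carry the `σ`-algebra generated by the coordinates `p ↦ p z`. -/
instance instMeasurableSpacePMFSite (d : ℕ) : MeasurableSpace (PMF (Site d)) :=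
  MeasurableSpace.comap (fun p z => p z) MeasurableSpace.pi

/-- An environment assigns to every site `x` the probability vector `ω x` of the jumps out of `x`:
`ω x z` is the probability of jumping from `x` to `x + z`. The space of environments has the product
`σ`-algebra. -/
abbrev Env (d : ℕ) : Type := Site d → PMF (Site d)

/-- The space of infinite paths, with the product `σ`-algebra. -/
abbrev Path (d : ℕ) : Type := ℕ → Site d

/-- The transition probability `π_{x,y}(ω) = ω_{x,y-x}`. -/
def trans {d : ℕ} (ω : Env d) (x y : Site d) : ℝ≥0∞ := ω x (y - x)

/-- `P` is an i.i.d. product measure: the vectors `ω x` are i.i.d. across the sites `x`. -/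
def IsIIDProduct {d : ℕ} (P : Measure (Env d)) : Prop :=
  ∃ μ : Measure (PMF (Site d)), IsProbabilityMeasure μ ∧ P = Measure.infinitePi fun _ : Site d => μ

/-- One step of the walk in the environment `ω`: from `x` the walk moves to `x + z`, where `z` has
law `ω x`. -/
def step {d : ℕ} (ω : Env d) : Kernel (Site d) (Site d) where
  toFun x := (ω x).toMeasure.map fun z => x + z
  measurable' := measurable_of_countable _

lemma step_singleton {d : ℕ} (ω : Env d) (x y : Site d) : step ω x {y} = trans ω x y := by
  have h : (fun z : Site d => x + z) ⁻¹' {y} = {y - x} := by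
    ext z
    simp only [Set.mem_preimage, Set.mem_singleton_iff]
    exact eq_sub_iff_add_eq'.symm
  change ((ω x).toMeasure.map fun z => x + z) {y} = _
  rw [Measure.map_apply (measurable_of_countable _) (measurableSet_singleton _), h,
    PMF.toMeasure_apply_singleton _ _ (measurableSet_singleton _)]
  rfl

instance instIsMarkovKernelStep {d : ℕ} (ω : Env d) : IsMarkovKernel (step ω) :=
  ⟨fun _ => Measure.isProbabilityMeasure_map (measurable_of_countable _).aemeasurable⟩

/-- The step kernel as a function of the whole past: only the present position matters. -/
def stepPast {d : ℕ} (ω : Env d) (n : ℕ) :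
    Kernel ((i : Finset.Iic n) → Site d) (Site d) :=
  (step ω).comap (fun h => h ⟨n, Finset.mem_Iic.2 le_rfl⟩) (measurable_pi_apply _)

instance instIsMarkovKernelStepPast {d : ℕ} (ω : Env d) (n : ℕ) : IsMarkovKernel (stepPast ω n) :=
  inferInstanceAs (IsMarkovKernel ((step ω).comap _ _))

/-- The quenched law `P_x^ω`: the law on path space of the Markov chain started at `x` with
transition probabilities `π_{x,y}(ω)`, obtained from the Ionescu-Tulcea theorem. -/
def quenchedLaw {d : ℕ} (ω : Env d) (x : Site d) : Measure (Path d) :=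
  Kernel.traj (X := fun _ => Site d) (stepPast ω) 0 fun _ => x

instance instIsProbabilityMeasureQuenchedLaw {d : ℕ} (ω : Env d) (x : Site d) :
    IsProbabilityMeasure (quenchedLaw ω x) :=
  inferInstanceAs (IsProbabilityMeasure (Kernel.traj (X := fun _ => Site d) (stepPast ω) 0 _))

lemma partialTraj_singleton {d : ℕ} (ω : Env d) (x : Site d) (y : Path d) (n : ℕ) :
    Kernel.partialTraj (X := fun _ => Site d) (stepPast ω) 0 n (fun _ => x)
      {fun i : Finset.Iic n => y i} =
    if y 0 = x then ∏ k ∈ Finset.range n, trans ω (y k) (y (k + 1)) else 0 := by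
  induction n with
  | zero =>
    rw [Kernel.partialTraj_self, Kernel.id_apply,
      Measure.dirac_apply' _ (measurableSet_singleton _)]
    by_cases hy : y 0 = x
    · rw [if_pos hy, Set.indicator_of_mem]
      · simp
      · rw [Set.mem_singleton_iff]
        funext i
        obtain ⟨i, hi⟩ := i
        obtain rfl : i = 0 := by simpa using hi
        exact hy.symm
    · rw [if_neg hy, Set.indicator_of_notMem]
      intro h
      rw [Set.mem_singleton_iff] at h
      exact hy (congrFun h ⟨0, by simp⟩).symm
  | succ n ih =>
    have hpt : ∀ h : (i : Finset.Iic n) → Site d,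
        Kernel.partialTraj (X := fun _ => Site d) (stepPast ω) n (n + 1) h
          {fun i : Finset.Iic (n + 1) => y i} =
        Set.indicator {fun i : Finset.Iic n => y i}
          (fun _ => trans ω (y n) (y (n + 1))) h := by
      intro h
      have hpre : (IicProdIoc (X := fun _ => Site d) n (n + 1)) ⁻¹'
          {fun i : Finset.Iic (n + 1) => y i} =
          {fun i : Finset.Iic n => y i} ×ˢ {fun i : Finset.Ioc n (n + 1) => y i} := by
        ext ⟨a, b⟩
        simp only [Set.mem_preimage, Set.mem_singleton_iff, Set.mem_prod]
        constructor
        · intro hab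
          constructor
          · funext i
            have hi := Finset.mem_Iic.1 i.2
            have := congrFun hab ⟨i, Finset.mem_Iic.2 (by omega)⟩
            simpa [IicProdIoc, hi] using this
          · funext i
            have hi := Finset.mem_Ioc.1 i.2
            have := congrFun hab ⟨i, Finset.mem_Iic.2 hi.2⟩
            simpa [IicProdIoc, not_le.2 hi.1] using this
        · rintro ⟨rfl, rfl⟩
          funext i
          simp only [IicProdIoc]
          split_ifs <;> rfl
      have hsing : (MeasurableEquiv.piSingleton (X := fun _ => Site d) n) ⁻¹'
          {fun i : Finset.Ioc n (n + 1) => y i} = {y (n + 1)} := by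
        ext z
        simp only [Set.mem_preimage, Set.mem_singleton_iff]
        constructor
        · intro hz
          have := congrFun hz ⟨n + 1, by simp⟩
          simpa [MeasurableEquiv.piSingleton] using this
        · rintro rfl
          funext i
          obtain ⟨i, hi⟩ := i
          obtain rfl : i = n + 1 := by
            have := Finset.mem_Ioc.1 hi
            omega
          rfl
      rw [Kernel.partialTraj_succ_self, Kernel.map_apply' _ (by fun_prop) _
        (measurableSet_singleton _), hpre, Kernel.id_prod_apply' _ _
        ((measurableSet_singleton _).prod (measurableSet_singleton _))]
      by_cases hh : h = fun i : Finset.Iic n => y i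
      · rw [Set.indicator_of_mem (Set.mem_singleton_iff.2 hh), Set.mk_preimage_prod_right
          (Set.mem_singleton_iff.2 hh), Kernel.map_apply' _ (MeasurableEquiv.measurable _) _
          (measurableSet_singleton _), hsing, ← step_singleton, stepPast, Kernel.comap_apply, hh]
      · rw [Set.indicator_of_notMem (fun h' => hh (Set.mem_singleton_iff.1 h')),
          Set.mk_preimage_prod_right_eq_empty (fun h' => hh (Set.mem_singleton_iff.1 h')),
          measure_empty]
    rw [Kernel.partialTraj_succ_eq_comp (Nat.zero_le n),
      Kernel.comp_apply' _ _ _ (measurableSet_singleton _)]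
    simp_rw [hpt]
    rw [lintegral_indicator_const (measurableSet_singleton _), ih, Finset.prod_range_succ, mul_comm]
    split_ifs <;> simp

/-- The finite-dimensional distributions of the quenched walk. -/
lemma quenchedLaw_cylinder {d : ℕ} (ω : Env d) (x : Site d) (y : Path d) (n : ℕ) :
    quenchedLaw ω x {X | ∀ i ≤ n, X i = y i} =
      if y 0 = x then ∏ k ∈ Finset.range n, trans ω (y k) (y (k + 1)) else 0 := by
  rw [← partialTraj_singleton, ← Kernel.traj_map_frestrictLe_apply,
    Measure.map_apply (by fun_prop) (measurableSet_singleton _), quenchedLaw]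
  congr 1
  ext X
  simp only [Set.mem_ofPred_eq, Set.mem_preimage, Set.mem_singleton_iff]
  constructor
  · intro h
    funext i
    exact h i (Finset.mem_Iic.1 i.2)
  · intro h i hi
    exact congrFun h ⟨i, Finset.mem_Iic.2 hi⟩

lemma measurable_trans {d : ℕ} (x y : Site d) : Measurable fun ω : Env d => trans ω x y := by
  have h : Measurable fun p : PMF (Site d) => p (y - x) :=
    (measurable_pi_apply (y - x)).comp (comap_measurable fun (p : PMF (Site d)) z => p z)
  exact h.comp (measurable_pi_apply x)

lemma measurable_partialTraj_singleton {d : ℕ} (x : Site d) (y : Path d) (n : ℕ) :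
    Measurable fun ω : Env d => Kernel.partialTraj (X := fun _ => Site d) (stepPast ω) 0 n
      (fun _ => x) {fun i : Finset.Iic n => y i} := by
  simp_rw [partialTraj_singleton]
  split_ifs
  · exact Finset.measurable_fun_prod _ fun k _ => measurable_trans _ _
  · exact measurable_const

lemma measurable_quenchedLaw {d : ℕ} (x : Site d) :
    Measurable fun ω : Env d => quenchedLaw ω x := by
  refine Measurable.measure_of_isPiSystem_of_isProbabilityMeasure
    generateFrom_measurableCylinders.symm isPiSystem_measurableCylinders fun s hs => ?_
  obtain ⟨n, S, hS, rfl⟩ : ∃ n S, MeasurableSet S ∧ s = cylinder (Finset.Iic n) S := by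
    simpa [measurableCylinders_nat] using hs
  have key : ∀ ω : Env d, quenchedLaw ω x (cylinder (Finset.Iic n) S) =
      ∑' h : ((i : Finset.Iic n) → Site d), S.indicator (fun h =>
        Kernel.partialTraj (X := fun _ => Site d) (stepPast ω) 0 n (fun _ => x) {h}) h := by
    intro ω
    rw [Measure.tsum_indicator_apply_singleton _ _ hS, ← Kernel.traj_map_frestrictLe_apply,
      Measure.map_apply (by fun_prop) hS]
    rfl
  simp_rw [key]
  refine Measurable.tsum fun h => ?_
  by_cases hh : h ∈ S
  · simp only [Set.indicator_of_mem hh]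
    obtain ⟨y, rfl⟩ : ∃ y : Path d, h = fun i : Finset.Iic n => y i := by
      refine ⟨fun k => if hk : k ≤ n then h ⟨k, Finset.mem_Iic.2 hk⟩ else 0, ?_⟩
      funext i
      simp [Finset.mem_Iic.1 i.2]
    exact measurable_partialTraj_singleton x y n
  · simp only [Set.indicator_of_notMem hh, measurable_const]

/-- The quenched laws `ω ↦ P_x^ω` as a Markov kernel from environments to paths. -/
def quenchedKernel {d : ℕ} (x : Site d) : Kernel (Env d) (Path d) where
  toFun ω := quenchedLaw ω x
  measurable' := measurable_quenchedLaw x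

instance instIsMarkovKernelQuenchedKernel {d : ℕ} (x : Site d) :
    IsMarkovKernel (quenchedKernel x) :=
  ⟨fun ω => instIsProbabilityMeasureQuenchedLaw ω x⟩

/-- The averaged law `P_x = ∫ P_x^ω P(dω)` of the walk started at `x`. -/
def averagedLaw {d : ℕ} (P : Measure (Env d)) (x : Site d) : Measure (Path d) :=
  P.bind (quenchedKernel x)

/-- The averaged law `P_{x,y} = ∫ P_x^ω ⊗ P_y^ω P(dω)` of two independent walks in a common
environment, started at `x` and `y`. -/
def averagedPairLaw {d : ℕ} (P : Measure (Env d)) (x y : Site d) : Measure (Path d × Path d) :=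
  P.bind (quenchedKernel x ×ₖ quenchedKernel y)

/-- The quenched mean `E_0^ω(X_n)`. -/
def quenchedMean {d : ℕ} (ω : Env d) (n : ℕ) : EuclideanSpace ℝ (Fin d) :=
  ∫ X, toE (X n) ∂(quenchedLaw ω 0)

/-- The averaged mean `E_0(X_n)`. -/
def averagedMean {d : ℕ} (P : Measure (Env d)) (n : ℕ) : EuclideanSpace ℝ (Fin d) :=
  ∫ X, toE (X n) ∂(averagedLaw P 0)

/-- Directional transience: `P_0{X_n · u → ∞} = 1`. -/
def IsTransient {d : ℕ} (P : Measure (Env d)) (u : Site d) : Prop :=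
  ∀ᵐ X ∂(averagedLaw P 0), Tendsto (fun n => X n ⬝ᵥ u) atTop atTop

/-- The time `t ≥ 1` satisfies `sup_{n < t} X_n · u < X_t · u = inf_{n ≥ t} X_n · u`. -/
def IsRegenerationTime {d : ℕ} (u : Site d) (X : Path d) (t : ℕ) : Prop :=
  1 ≤ t ∧ (∀ n < t, X n ⬝ᵥ u < X t ⬝ᵥ u) ∧ ∀ n ≥ t, X t ⬝ᵥ u ≤ X n ⬝ᵥ u

/-- The first regeneration time `τ_1`, equal to `∞` if there is none. -/
def firstRegenerationTime {d : ℕ} (u : Site d) (X : Path d) : ℕ∞ :=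
  ⨅ (t : ℕ) (_ : IsRegenerationTime u X t), (t : ℕ∞)

/-- The moment `E_0(τ_1^p) ∈ [0, ∞]` of the first regeneration time. -/
def regenerationMoment {d : ℕ} (P : Measure (Env d)) (u : Site d) (p : ℝ) : ℝ≥0∞ :=
  ∫⁻ X, (firstRegenerationTime u X : ℝ≥0∞) ^ p ∂(averagedLaw P 0)

/-- Bounded steps: there is a finite deterministic `M > 0` such that `π_{0,z} = 0` almost surely
whenever `|z| > M`. -/
def HasBoundedSteps {d : ℕ} (P : Measure (Env d)) : Prop :=
  ∃ M : ℝ, 0 < M ∧ ∀ z : Site d, M < ‖toE z‖ → ∀ᵐ ω ∂P, trans ω 0 z = 0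

/-- The set of sites `X_{[0,n)} = {X_k : 0 ≤ k < n}` visited by the path before time `n`. -/
def visited {d : ℕ} (X : Path d) (n : ℕ) : Set (Site d) :=
  {x | ∃ k < n, X k = x}

/-- The expected number `E_{0,0}|X_{[0,n)} ∩ X̃_{[0,n)}|` of common sites of two independent walks
in a common environment. -/
def expectedIntersections {d : ℕ} (P : Measure (Env d)) (n : ℕ) : ℝ :=
  ∫ XY, ((visited XY.1 n ∩ visited XY.2 n).ncard : ℝ) ∂(averagedPairLaw P 0 0)

/-- The variance `𝔼[|E_0^ω(X_n) - E_0(X_n)|²]` of the quenched mean. -/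
def quenchedMeanVariance {d : ℕ} (P : Measure (Env d)) (n : ℕ) : ℝ :=
  ∫ ω, ‖quenchedMean ω n - averagedMean P n‖ ^ 2 ∂P

end RWRE

end

/-! The quenched mean is a function of the independent vectors `ω x`. Expose them in the order of
the level `x ⬝ᵥ u`. The variance is then a sum of squared martingale increments, and
`IsIIDProduct.variance_le_sum` bounds the increment at `z` by the `L²` distance between the
conditional mean given `T` and any function that ignores `ω z`. Here `T` consists of `z` and exposed
sites that are not above it.

The comparison function is built from `blindMean`: if the walk first hits `z` at time `k < n`, its
final position is replaced by `z` plus the mean displacement over time `n - k` of a walk conditioned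
not to backtrack. At the first regeneration time `t > k` the walk stands strictly above `T` and
never returns below that level. It then sees fresh environment, and its remaining displacement has
the same conditioned mean whatever `ω z` is (`IsIIDProduct.partialLaw_renewal`,
`IsIIDProduct.setIntegral_nextRegeneration_eq_zero`). Hence `ω z` matters only through the gap `t -
k`.

Gaps up to `ℓ` cost a multiple of `ℓ` times the probability of hitting `z`. The squared quenched
hitting probability is the chance that two independent walks both hit `z`, so the squares sum to
`ℓ²` times the expected number of intersections. Longer gaps cost at most a multiple of `n⁴` times
the probability of no regeneration in `(0, ℓ]`. With `ℓ` of order `n ^ (α - αbar)` the first term is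
`O(n ^ (2α))`, and the moment of `τ_1` keeps the second bounded. -/

namespace RWRE

/-! ### Events determined by finitely many steps -/

/-- The paths that agree with `y` up to time `n`. -/
def cyl {d : ℕ} (y : Path d) (n : ℕ) : Set (Path d) := {X | ∀ i ≤ n, X i = y i}

/-- The first `n + 1` positions of a path. -/
def initial {d : ℕ} (n : ℕ) (X : Path d) : Fin (n + 1) → Site d := fun i => X i

/-- The path that follows `h` and then stays put. -/
def extend {d n : ℕ} (h : Fin (n + 1) → Site d) : Path d :=
  fun k => h ⟨min k n, by omega⟩

lemma initial_extend {d n : ℕ} (h : Fin (n + 1) → Site d) : initial n (extend h) = h := by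
  funext i
  have : min (i : ℕ) n = i := by omega
  simp [initial, extend, this]

lemma extend_initial {d n k : ℕ} (X : Path d) (hk : k ≤ n) : extend (initial n X) k = X k := by
  simp [initial, extend, hk]

lemma measurable_initial {d : ℕ} (n : ℕ) : Measurable (initial (d := d) n) :=
  measurable_pi_lambda _ fun i => measurable_pi_apply (i : ℕ)

/-- Paths of length `n` form a countable discrete space, so any function that factors through
`initial n` is measurable. -/
lemma measurable_of_dependsOn {d n : ℕ} {β : Type*} [MeasurableSpace β] {Φ : Path d → β}
    (h : DependsOn Φ (Set.Iic n)) : Measurable Φ := by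
  have : Φ = (fun h => Φ (extend h)) ∘ initial n := by
    funext X
    exact h fun k hk => (extend_initial X hk).symm
  rw [this]
  exact (measurable_of_countable _).comp (measurable_initial n)

lemma measurableSet_of_dependsOn {d n : ℕ} {A : Set (Path d)}
    (h : DependsOn (· ∈ A) (Set.Iic n)) : MeasurableSet A :=
  measurableSet_setOfPred.2 (measurable_of_dependsOn h)

lemma dependsOn_cyl {d : ℕ} (y : Path d) (n : ℕ) : DependsOn (· ∈ cyl y n) (Set.Iic n) := by
  intro X Y h
  refine propext (forall₂_congr fun i hi => ?_)
  rw [h i hi]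

lemma measurableSet_cyl {d : ℕ} (y : Path d) (n : ℕ) : MeasurableSet (cyl y n) :=
  measurableSet_of_dependsOn (dependsOn_cyl y n)

/-- An event decided by time `n` is a countable disjoint union of cylinders around its own members.
Only `y ∈ A` need be tested, so the defining property of `A` is available in the test. -/
lemma measure_eq_of_cyl {d n : ℕ} {μ ν : Measure (Path d)} {A : Set (Path d)}
    (hA : DependsOn (· ∈ A) (Set.Iic n)) (h : ∀ y ∈ A, μ (cyl y n) = ν (cyl y n)) :
    μ A = ν A := by
  have hU : A = ⋃ g : {g : Fin (n + 1) → Site d // extend g ∈ A}, cyl (extend g.1) n := by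
    ext X
    rw [Set.mem_iUnion]
    constructor
    · intro hX
      refine ⟨⟨initial n X, ?_⟩, fun i hi => (extend_initial X hi).symm⟩
      exact (hA (x := X) fun k hk => (extend_initial X hk).symm).mp hX
    · rintro ⟨g, hg⟩
      exact (hA (x := X) hg).mpr g.2
  have hdisj : Pairwise (Function.onFun Disjoint
      fun g : {g : Fin (n + 1) → Site d // extend g ∈ A} => cyl (extend g.1) n) := by
    intro g g' hne
    refine Set.disjoint_left.2 fun X hX hX' => hne (Subtype.ext ?_)
    rw [← initial_extend g.1, ← initial_extend g'.1]
    funext i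
    exact (hX i (by omega)).symm.trans (hX' i (by omega))
  rw [hU, measure_iUnion hdisj fun g => measurableSet_cyl _ _,
    measure_iUnion hdisj fun g => measurableSet_cyl _ _]
  exact tsum_congr fun g => h _ g.2

lemma ext_of_cyl {d : ℕ} {μ ν : Measure (Path d)} [IsFiniteMeasure μ]
    (h : ∀ y n, μ (cyl y n) = ν (cyl y n)) : μ = ν := by
  refine ext_of_generate_finite _ generateFrom_measurableCylinders.symm
    isPiSystem_measurableCylinders (fun s hs => ?_)
    (measure_eq_of_cyl (n := 0) (fun _ _ _ => rfl) fun y _ => h y 0)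
  obtain ⟨n, S, hS, rfl⟩ : ∃ n S, MeasurableSet S ∧ s = cylinder (Finset.Iic n) S := by
    simpa [measurableCylinders_nat] using hs
  refine measure_eq_of_cyl (n := n) (fun X Y hXY => ?_) fun y _ => h y n
  simp only [mem_cylinder]
  congr! 1
  funext i
  exact hXY _ (Finset.mem_Iic.1 i.2)

/-! ### The Markov property and locality of the quenched law -/

lemma quenchedLaw_cyl {d : ℕ} (ω : Env d) (x : Site d) (y : Path d) (n : ℕ) :
    quenchedLaw ω x (cyl y n) =
      if y 0 = x then ∏ k ∈ Finset.range n, trans ω (y k) (y (k + 1)) else 0 :=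
  quenchedLaw_cylinder ω x y n

/-- The path seen from its position at time `t`. -/
def future {d : ℕ} (t : ℕ) (X : Path d) : Path d := fun k => X (t + k) - X t

/-- The environment seen from the site `x`. -/
def envShift {d : ℕ} (x : Site d) (ω : Env d) : Env d := fun v => ω (x + v)

lemma measurable_future {d : ℕ} (t : ℕ) : Measurable (future (d := d) t) :=
  measurable_pi_lambda _ fun k =>
    (measurable_pi_apply (t + k)).sub (measurable_pi_apply t)

lemma measurable_envShift {d : ℕ} (x : Site d) : Measurable (envShift x) :=
  measurable_pi_lambda _ fun v => measurable_pi_apply (x + v)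

lemma trans_envShift {d : ℕ} (x : Site d) (ω : Env d) (a b : Site d) :
    trans (envShift x ω) a b = trans ω (x + a) (x + b) := by
  simp [trans, envShift]

/-- The Markov property as an identity of measures: on cylinders, the product of transition
probabilities splits at time `t`. -/
lemma restrict_cyl_map_future {d : ℕ} (ω : Env d) (x : Site d) (y : Path d) (t : ℕ) :
    ((quenchedLaw ω x).restrict (cyl y t)).map (future t) =
      quenchedLaw ω x (cyl y t) • quenchedLaw (envShift (y t) ω) 0 := by
  refine ext_of_cyl fun y' n => ?_
  rw [Measure.map_apply (measurable_future t) (measurableSet_cyl _ _),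
    Measure.restrict_apply (measurable_future t (measurableSet_cyl _ _)), Measure.smul_apply,
    smul_eq_mul]
  by_cases h0 : y' 0 = 0
  · have hset : future t ⁻¹' cyl y' n ∩ cyl y t =
        cyl (fun k => if k ≤ t then y k else y t + y' (k - t)) (t + n) := by
      ext X
      constructor
      · rintro ⟨h1, h2⟩ i hi
        by_cases hit : i ≤ t
        · simpa [hit] using h2 i hit
        · have := h1 (i - t) (by omega)
          simp only [future] at this
          rw [show t + (i - t) = i by omega, h2 t le_rfl] at this
          simp [hit, ← this]
      · intro h
        have h2 : X ∈ cyl y t := fun i hi => by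
          simpa [hi] using h i (by omega)
        refine ⟨fun i hi => ?_, h2⟩
        simp only [future]
        have := h (t + i) (by omega)
        rw [this, h2 t le_rfl]
        -- At the junction time `t` both halves prescribe the position; they agree because `y' 0 =
        -- 0`.
        rcases Nat.eq_zero_or_pos i with rfl | hi'
        · simp [h0]
        · simp [hi'.ne']
    rw [hset, quenchedLaw_cyl, quenchedLaw_cyl, quenchedLaw_cyl, if_pos h0]
    simp only [Nat.zero_le, if_true]
    split_ifs
    · rw [Finset.prod_range_add]
      congr 1
      · refine Finset.prod_congr rfl fun k hk => ?_
        have := Finset.mem_range.1 hk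
        rw [if_pos (by omega), if_pos (by omega)]
      · refine Finset.prod_congr rfl fun k hk => ?_
        rw [trans_envShift, if_neg (show ¬ t + k + 1 ≤ t by omega),
          show t + k + 1 - t = k + 1 by omega]
        congr 1
        rcases Nat.eq_zero_or_pos k with rfl | hk'
        · simp [h0]
        · simp [hk'.ne']
    · simp
  · have hset : future t ⁻¹' cyl y' n ∩ cyl y t = ∅ := by
      ext X
      simp only [Set.mem_inter_iff, Set.mem_empty_iff_false, iff_false, not_and]
      intro h1
      exact absurd (by simpa [future] using (h1 0 (Nat.zero_le _)).symm) h0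
    rw [hset, quenchedLaw_cyl (envShift _ _), if_neg h0]
    simp

lemma quenchedLaw_markov {d : ℕ} (ω : Env d) (x : Site d) (y : Path d) (t : ℕ)
    {B : Set (Path d)} (hB : MeasurableSet B) :
    quenchedLaw ω x (cyl y t ∩ future t ⁻¹' B) =
      quenchedLaw ω x (cyl y t) * quenchedLaw (envShift (y t) ω) 0 B := by
  have := congrArg (fun μ => μ B) (restrict_cyl_map_future ω x y t)
  rwa [Measure.map_apply (measurable_future t) hB,
    Measure.restrict_apply (measurable_future t hB), Set.inter_comm] at this

/-- The strict inequality `k < N` matters: no jump out of the site occupied at time `N` is used, so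
that site need not lie in `H`. -/
lemma quenchedLaw_congr {d N : ℕ} {ω ω' : Env d} {H : Set (Site d)} (h : ∀ x ∈ H, ω x = ω' x)
    (x : Site d) {A : Set (Path d)} (hA : DependsOn (· ∈ A) (Set.Iic N))
    (hs : ∀ X ∈ A, ∀ k < N, X k ∈ H) : quenchedLaw ω x A = quenchedLaw ω' x A := by
  refine measure_eq_of_cyl hA fun y hy => ?_
  rw [quenchedLaw_cyl, quenchedLaw_cyl]
  congr 1
  refine Finset.prod_congr rfl fun k hk => ?_
  rw [trans, trans, h _ (hs y hy k (Finset.mem_range.1 hk))]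

lemma dependsOn_mem_inter {ι : Type*} {α : ι → Type*} {s : Set ι} {A B : Set (∀ i, α i)}
    (hA : DependsOn (· ∈ A) s) (hB : DependsOn (· ∈ B) s) : DependsOn (· ∈ A ∩ B) s := by
  intro X Y h
  simp only [Set.mem_inter_iff]
  exact congrArg₂ And (hA h) (hB h)

lemma setIntegral_quenchedLaw_congr {d N : ℕ} {ω ω' : Env d} {H : Set (Site d)}
    (h : ∀ x ∈ H, ω x = ω' x) (x : Site d) {A : Set (Path d)}
    (hA : DependsOn (· ∈ A) (Set.Iic N)) (hs : ∀ X ∈ A, ∀ k < N, X k ∈ H) {Φ : Path d → ℝ}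
    (hΦ : DependsOn Φ (Set.Iic N)) :
    ∫ X in A, Φ X ∂(quenchedLaw ω x) = ∫ X in A, Φ X ∂(quenchedLaw ω' x) := by
  have hmap : ((quenchedLaw ω x).restrict A).map (initial N) =
      ((quenchedLaw ω' x).restrict A).map (initial N) := by
    refine Measure.ext fun s hs' => ?_
    rw [Measure.map_apply (measurable_initial N) hs', Measure.map_apply (measurable_initial N) hs',
      Measure.restrict_apply (measurable_initial N hs'),
      Measure.restrict_apply (measurable_initial N hs')]
    refine quenchedLaw_congr h x (dependsOn_mem_inter (fun X Y hXY => ?_) hA)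
      fun X hX => hs X hX.2
    have : initial N X = initial N Y := by
      funext i
      exact hXY _ (Set.mem_Iic.2 (by omega))
    simp [this]
  have hcomp : Φ = fun X => Φ (extend (initial N X)) := by
    funext X
    exact hΦ fun k hk => (extend_initial X hk).symm
  have hkey : ∀ ω : Env d, ∫ X in A, Φ X ∂(quenchedLaw ω x) =
      ∫ g, Φ (extend g) ∂(((quenchedLaw ω x).restrict A).map (initial N)) := by
    intro ω
    rw [integral_map (measurable_initial N).aemeasurable
      (measurable_of_countable _).aestronglyMeasurable]
    conv_lhs => rw [hcomp]
  rw [hkey, hkey, hmap]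

/-- The paths that never go below level `0` in direction `u`. -/
def noBacktrack {d : ℕ} (u : Site d) : Set (Path d) := {X | ∀ k, 0 ≤ X k ⬝ᵥ u}

lemma measurableSet_noBacktrack {d : ℕ} (u : Site d) : MeasurableSet (noBacktrack u) := by
  rw [show noBacktrack u = ⋂ k, {X : Path d | 0 ≤ X k ⬝ᵥ u} by ext X; simp [noBacktrack]]
  refine MeasurableSet.iInter fun k => measurableSet_of_dependsOn (n := k) fun X Y h => ?_
  simp [h k (Set.mem_Iic.2 le_rfl)]

/-- Infinite-horizon locality: `B` is not decided in finite time, so `noBacktrack u` is approximated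
from outside by the decreasing events of staying above level `0` up to time `n + N`. -/
lemma quenchedLaw_congr_noBacktrack {d : ℕ} {ω ω' : Env d} {u : Site d}
    (h : ∀ x : Site d, 0 ≤ x ⬝ᵥ u → ω x = ω' x) (x : Site d) {B : Set (Path d)}
    (hB : MeasurableSet B) (hBu : B ⊆ noBacktrack u) :
    quenchedLaw ω x B = quenchedLaw ω' x B := by
  suffices hres : (quenchedLaw ω x).restrict (noBacktrack u) =
      (quenchedLaw ω' x).restrict (noBacktrack u) by
    have := congrArg (fun μ => μ B) hres
    simpa [Measure.restrict_apply hB, Set.inter_eq_left.2 hBu] using this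
  refine ext_of_cyl fun y n => ?_
  rw [Measure.restrict_apply (measurableSet_cyl y n), Measure.restrict_apply (measurableSet_cyl y n)]
  let A : ℕ → Set (Path d) := fun N => cyl y n ∩ {X | ∀ k ≤ n + N, 0 ≤ X k ⬝ᵥ u}
  have hAdep : ∀ N, DependsOn (· ∈ A N) (Set.Iic (n + N)) := fun N => by
    refine dependsOn_mem_inter (fun X Y hXY => dependsOn_cyl y n fun i hi => hXY i ?_)
      fun X Y hXY => propext (forall₂_congr fun k hk => ?_)
    · exact Set.mem_Iic.2 (le_trans hi (Nat.le_add_right _ _))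
    · rw [hXY k hk]
  have hset : cyl y n ∩ noBacktrack u = ⋂ N, A N := by
    ext X
    simp only [A, noBacktrack, Set.mem_inter_iff, Set.mem_iInter, Set.mem_ofPred_eq]
    exact ⟨fun hX N => ⟨hX.1, fun k _ => hX.2 k⟩,
      fun hX => ⟨(hX 0).1, fun k => (hX k).2 k (by omega)⟩⟩
  have hanti : Antitone A := fun N N' hN X hX => ⟨hX.1, fun k hk => hX.2 k (by omega)⟩
  have hmeas : ∀ N, MeasurableSet (A N) := fun N => measurableSet_of_dependsOn (hAdep N)
  rw [hset, hanti.measure_iInter (fun N => (hmeas N).nullMeasurableSet) ⟨0, measure_ne_top _ _⟩,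
    hanti.measure_iInter (fun N => (hmeas N).nullMeasurableSet) ⟨0, measure_ne_top _ _⟩]
  refine iInf_congr fun N => quenchedLaw_congr (H := {x | 0 ≤ x ⬝ᵥ u}) h x (hAdep N) ?_
  exact fun X hX k hk => hX.2 k hk.le

/-! ### Resampling and shifting the environment -/

open Classical in
/-- The environment that agrees with `ω` on `T` and with `ω'` off `T`. -/
noncomputable def merge {d : ℕ} (T : Set (Site d)) (ω ω' : Env d) : Env d :=
  fun x => if x ∈ T then ω x else ω' x

lemma merge_of_mem {d : ℕ} {T : Set (Site d)} {x : Site d} (hx : x ∈ T) (ω ω' : Env d) :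
    merge T ω ω' x = ω x := if_pos hx

lemma merge_of_notMem {d : ℕ} {T : Set (Site d)} {x : Site d} (hx : x ∉ T) (ω ω' : Env d) :
    merge T ω ω' x = ω' x := if_neg hx

lemma measurable_merge {d : ℕ} (T : Set (Site d)) :
    Measurable fun p : Env d × Env d => merge T p.1 p.2 := by
  refine measurable_pi_lambda _ fun x => ?_
  by_cases hx : x ∈ T
  · simp only [merge_of_mem hx]
    exact (measurable_pi_apply x).comp measurable_fst
  · simp only [merge_of_notMem hx]
    exact (measurable_pi_apply x).comp measurable_snd

lemma measurable_merge_right {d : ℕ} (T : Set (Site d)) (ω : Env d) :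
    Measurable (merge T ω) :=
  (measurable_merge T).comp measurable_prodMk_left

lemma IsIIDProduct.isProbabilityMeasure {d : ℕ} {P : Measure (Env d)} (hP : IsIIDProduct P) :
    IsProbabilityMeasure P := by
  obtain ⟨μ, _, rfl⟩ := hP
  infer_instance

/-- Resampling the environment off `T` preserves its law. Conditioning and independence are both
derived from this fact by Fubini. -/
lemma IsIIDProduct.measurePreserving_merge {d : ℕ} {P : Measure (Env d)} (hP : IsIIDProduct P)
    (T : Set (Site d)) :
    MeasurePreserving (fun p : Env d × Env d => merge T p.1 p.2) (P.prod P) P := by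
  classical
  obtain ⟨μ, _, rfl⟩ := hP
  refine ⟨measurable_merge T, Measure.eq_infinitePi _ fun s t ht => ?_⟩
  have hset : (fun p : Env d × Env d => merge T p.1 p.2) ⁻¹' Set.pi s t =
      Set.pi (s.filter (· ∈ T) : Finset (Site d)) t ×ˢ
        Set.pi (s.filter (· ∉ T) : Finset (Site d)) t := by
    ext ⟨ω, ω'⟩
    simp only [Set.mem_preimage, Set.mem_pi, Set.mem_prod, Finset.coe_filter, Set.mem_ofPred_eq,
      Finset.mem_coe]
    constructor
    · intro h
      refine ⟨fun x hx => ?_, fun x hx => ?_⟩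
      · simpa [merge_of_mem hx.2] using h x hx.1
      · simpa [merge_of_notMem hx.2] using h x hx.1
    · rintro ⟨h1, h2⟩ x hx
      by_cases hxT : x ∈ T
      · simpa [merge_of_mem hxT] using h1 x ⟨hx, hxT⟩
      · simpa [merge_of_notMem hxT] using h2 x ⟨hx, hxT⟩
  rw [Measure.map_apply (measurable_merge T)
    (MeasurableSet.pi s.countable_toSet fun i _ => ht i), hset, Measure.prod_prod,
    Measure.infinitePi_pi _ fun i _ => ht i, Measure.infinitePi_pi _ fun i _ => ht i,
    Finset.prod_filter_mul_prod_filter_not]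

lemma IsIIDProduct.measurePreserving_envShift {d : ℕ} {P : Measure (Env d)}
    (hP : IsIIDProduct P) (x : Site d) : MeasurePreserving (envShift x) P P := by
  classical
  obtain ⟨μ, _, rfl⟩ := hP
  refine ⟨measurable_envShift x, Measure.eq_infinitePi _ fun s t ht => ?_⟩
  have hset : envShift x ⁻¹' Set.pi s t =
      Set.pi (s.map (addLeftEmbedding x) : Finset (Site d)) fun v => t (v - x) := by
    ext ω
    simp only [Set.mem_preimage, Set.mem_pi, Finset.mem_coe, envShift, Finset.mem_map,
      addLeftEmbedding_apply, forall_exists_index, and_imp, forall_apply_eq_imp_iff₂,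
      add_sub_cancel_left]
  rw [Measure.map_apply (measurable_envShift x)
    (MeasurableSet.pi s.countable_toSet fun i _ => ht i), hset,
    Measure.infinitePi_pi _ fun i _ => ht _, Finset.prod_map]
  simp

lemma IsIIDProduct.lintegral_mul_of_dependsOn {d : ℕ} {P : Measure (Env d)} (hP : IsIIDProduct P)
    {S : Set (Site d)} {F G : Env d → ℝ≥0∞} (hF : Measurable F) (hG : Measurable G)
    (hFS : DependsOn F S) (hGS : DependsOn G Sᶜ) :
    ∫⁻ ω, F ω * G ω ∂P = (∫⁻ ω, F ω ∂P) * ∫⁻ ω, G ω ∂P := by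
  have := hP.isProbabilityMeasure
  rw [← (hP.measurePreserving_merge S).lintegral_comp (f := fun ω => F ω * G ω) (hF.mul hG)]
  have hpt : ∀ p : Env d × Env d, F (merge S p.1 p.2) * G (merge S p.1 p.2) = F p.1 * G p.2 :=
    fun p => congrArg₂ _ (hFS fun x hx => merge_of_mem hx _ _)
      (hGS fun x hx => merge_of_notMem hx _ _)
  simp_rw [hpt]
  exact lintegral_prod_mul hF.aemeasurable hG.aemeasurable

/-! ### The averaged laws -/

instance {d : ℕ} (Q : Measure (Env d)) [IsProbabilityMeasure Q] (x : Site d) :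
    IsProbabilityMeasure (averagedLaw Q x) :=
  inferInstanceAs (IsProbabilityMeasure (Q.bind (quenchedKernel x)))

lemma averagedLaw_apply {d : ℕ} (Q : Measure (Env d)) (x : Site d) {A : Set (Path d)}
    (hA : MeasurableSet A) : averagedLaw Q x A = ∫⁻ ω, quenchedLaw ω x A ∂Q :=
  Measure.bind_apply hA (quenchedKernel x).aemeasurable

lemma measurable_quenchedLaw_apply {d : ℕ} (x : Site d) {A : Set (Path d)}
    (hA : MeasurableSet A) : Measurable fun ω : Env d => quenchedLaw ω x A :=
  (Measure.measurable_coe hA).comp (measurable_quenchedLaw x)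

/-- The law of the walk when the environment is frozen to be `ω` on `T` and averaged off `T`. -/
noncomputable def partialLaw {d : ℕ} (P : Measure (Env d)) (T : Set (Site d)) (ω : Env d) :
    Measure (Path d) := averagedLaw (P.map (merge T ω)) 0

instance {d : ℕ} (P : Measure (Env d)) [IsProbabilityMeasure P] (T : Set (Site d)) (ω : Env d) :
    IsProbabilityMeasure (partialLaw P T ω) :=
  have := Measure.isProbabilityMeasure_map (μ := P) (measurable_merge_right T ω).aemeasurable
  inferInstanceAs (IsProbabilityMeasure (averagedLaw _ _))

lemma partialLaw_apply {d : ℕ} (P : Measure (Env d)) (T : Set (Site d)) (ω : Env d)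
    {A : Set (Path d)} (hA : MeasurableSet A) :
    partialLaw P T ω A = ∫⁻ ω', quenchedLaw (merge T ω ω') 0 A ∂P := by
  rw [partialLaw, averagedLaw_apply _ _ hA,
    lintegral_map (measurable_quenchedLaw_apply 0 hA) (measurable_merge_right T ω)]

lemma partialLaw_empty {d : ℕ} (P : Measure (Env d)) (ω : Env d) :
    partialLaw P ∅ ω = averagedLaw P 0 := by
  have : merge ∅ ω = id := by
    funext ω' x
    exact merge_of_notMem (Set.notMem_empty x) _ _
  rw [partialLaw, this, Measure.map_id]

/-- The paths that reach a strict record at time `t`, above all sites of `T`. -/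
def freshRecord {d : ℕ} (u : Site d) (T : Set (Site d)) (t : ℕ) : Set (Path d) :=
  {X | (∀ k < t, X k ⬝ᵥ u < X t ⬝ᵥ u) ∧ ∀ x ∈ T, x ⬝ᵥ u < X t ⬝ᵥ u}

/-- The renewal structure: after a fresh record that is never undercut, the walk forgets its past
and the frozen part of the environment. -/
lemma IsIIDProduct.partialLaw_renewal {d : ℕ} {P : Measure (Env d)} (hP : IsIIDProduct P)
    {u : Site d} {T : Set (Site d)} (ω : Env d) {t : ℕ} {A B : Set (Path d)}
    (hA : DependsOn (· ∈ A) (Set.Iic t)) (hAT : A ⊆ freshRecord u T t)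
    (hB : MeasurableSet B) (hBu : B ⊆ noBacktrack u) :
    partialLaw P T ω (A ∩ future t ⁻¹' B) = partialLaw P T ω A * averagedLaw P 0 B := by
  have := hP.isProbabilityMeasure
  have hfB := measurable_future t hB
  suffices h : (partialLaw P T ω).restrict (future t ⁻¹' B) A =
      (averagedLaw P 0 B • partialLaw P T ω) A by
    rw [Measure.restrict_apply (measurableSet_of_dependsOn hA), Measure.smul_apply,
      smul_eq_mul] at h
    rw [h, mul_comm]
  refine measure_eq_of_cyl hA fun y hy => ?_
  obtain ⟨hy1, hy2⟩ := hAT hy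
  have hmc := measurableSet_cyl y t
  rw [Measure.restrict_apply hmc, Measure.smul_apply, smul_eq_mul,
    partialLaw_apply _ _ _ (hmc.inter hfB), partialLaw_apply _ _ _ hmc]
  simp_rw [quenchedLaw_markov _ _ _ _ hB]
  -- Sites at or above the level of `y t` lie outside `T`, so the future after `t` sees only the
  -- averaged part of the environment.
  have hG : ∀ ω' : Env d, quenchedLaw (envShift (y t) (merge T ω ω')) 0 B =
      quenchedLaw (envShift (y t) ω') 0 B := fun ω' =>
    quenchedLaw_congr_noBacktrack (fun x hx => merge_of_notMem (fun hxT => by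
      have := hy2 _ hxT
      rw [add_dotProduct] at this
      linarith) _ _) 0 hB hBu
  simp_rw [hG]
  -- The level of `y t` separates the two factors: before `t` the walk jumps only from sites
  -- strictly below it, and after `t` only from sites at or above it.
  rw [hP.lintegral_mul_of_dependsOn (S := {x | x ⬝ᵥ u < y t ⬝ᵥ u})
    (F := fun ω' => quenchedLaw (merge T ω ω') 0 (cyl y t))
    (G := fun ω' => quenchedLaw (envShift (y t) ω') 0 B)
    ((measurable_quenchedLaw_apply 0 hmc).comp (measurable_merge_right T ω))
    ((measurable_quenchedLaw_apply 0 hB).comp (measurable_envShift (y t)))]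
  · rw [mul_comm, averagedLaw_apply _ _ hB,
      ← (hP.measurePreserving_envShift (y t)).lintegral_comp (measurable_quenchedLaw_apply 0 hB)]
  · intro ω₁ ω₂ h
    refine quenchedLaw_congr (H := {x | x ⬝ᵥ u < y t ⬝ᵥ u}) (fun x hx => ?_) 0
      (dependsOn_cyl y t) fun X hX k hk => ?_
    · by_cases hxT : x ∈ T
      · rw [merge_of_mem hxT, merge_of_mem hxT]
      · rw [merge_of_notMem hxT, merge_of_notMem hxT, h x hx]
    · rw [hX k hk.le]
      exact hy1 k hk
  · intro ω₁ ω₂ h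
    refine quenchedLaw_congr_noBacktrack (fun x hx => h _ ?_) 0 hB hBu
    simp only [Set.mem_compl_iff, Set.mem_ofPred_eq, not_lt, add_dotProduct]
    linarith

/-! ### Gaps between regeneration times -/

/-- Separates the condition into an event decided by time `t` and an event of the future, the form
required by the renewal property. -/
lemma isRegenerationTime_iff {d : ℕ} {u : Site d} {X : Path d} {t : ℕ} :
    IsRegenerationTime u X t ↔ 1 ≤ t ∧ X ∈ freshRecord u ∅ t ∧ future t X ∈ noBacktrack u := by
  simp only [IsRegenerationTime, freshRecord, noBacktrack, future, Set.mem_ofPred_eq,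
    Set.mem_empty_iff_false, false_imp_iff, implies_true, and_true, sub_dotProduct, sub_nonneg]
  refine and_congr_right fun _ => and_congr_right fun _ => ⟨fun h k => h _ (by omega), fun h n hn => ?_⟩
  have := h (n - t)
  rwa [show t + (n - t) = n by omega] at this

lemma dependsOn_freshRecord {d : ℕ} (u : Site d) (T : Set (Site d)) (t : ℕ) :
    DependsOn (· ∈ freshRecord u T t) (Set.Iic t) := by
  intro X Y h
  have ht := h t (Set.mem_Iic.2 le_rfl)
  refine propext (and_congr (forall₂_congr fun k hk => ?_) (forall₂_congr fun x _ => ?_))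
  · rw [h k hk.le, ht]
  · rw [ht]

/-- The paths without regeneration time in `(k, k + ℓ]`. -/
def noRegeneration {d : ℕ} (u : Site d) (k ℓ : ℕ) : Set (Path d) :=
  {X | ∀ t, k < t → t ≤ k + ℓ → ¬ IsRegenerationTime u X t}

lemma measurableSet_isRegenerationTime {d : ℕ} (u : Site d) (t : ℕ) :
    MeasurableSet {X : Path d | IsRegenerationTime u X t} := by
  have : {X : Path d | IsRegenerationTime u X t} =
      {X | 1 ≤ t} ∩ (freshRecord u ∅ t ∩ future t ⁻¹' noBacktrack u) := by
    ext X
    exact isRegenerationTime_iff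
  rw [this]
  exact (MeasurableSet.const _).inter
    ((measurableSet_of_dependsOn (dependsOn_freshRecord u ∅ t)).inter
      (measurable_future t (measurableSet_noBacktrack u)))

lemma measurableSet_noRegeneration {d : ℕ} (u : Site d) (k ℓ : ℕ) :
    MeasurableSet (noRegeneration u k ℓ) := by
  have : noRegeneration u k ℓ =
      ⋂ t ∈ Finset.Ioc k (k + ℓ), {X : Path d | IsRegenerationTime u X t}ᶜ := by
    ext X
    simp [noRegeneration]
  rw [this]
  exact Finset.measurableSet_biInter _ fun t _ => (measurableSet_isRegenerationTime u t).compl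

lemma isRegenerationTime_add {d : ℕ} {u : Site d} {X : Path d} {s t : ℕ}
    (hs : IsRegenerationTime u X s) (ht : IsRegenerationTime u (future s X) t) :
    IsRegenerationTime u X (s + t) := by
  obtain ⟨h1, h2, h3⟩ := hs
  obtain ⟨g1, g2, g3⟩ := ht
  simp only [future, sub_dotProduct, sub_lt_sub_iff_right, sub_le_sub_iff_right] at g2 g3
  refine ⟨by omega, fun n hn => ?_, fun n hn => ?_⟩
  · by_cases hns : n < s
    · exact (h2 n hns).trans_le (h3 _ (by omega))
    · simpa [show s + (n - s) = n by omega] using g2 (n - s) (by omega)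
  · simpa [show s + (n - s) = n by omega] using g3 (n - s) (by omega)

/-- Decompose by the last regeneration time `s ≤ k`, with `s = 0` if there is none. The walk seen
from `s` has no regeneration in `(0, ℓ]`, and renewal bounds each of the `k + 1` cases by the same
probability. -/
lemma IsIIDProduct.averagedLaw_noRegeneration_le {d : ℕ} {P : Measure (Env d)}
    (hP : IsIIDProduct P) (u : Site d) (k ℓ : ℕ) :
    averagedLaw P 0 (noRegeneration u k ℓ) ≤
      (k + 1 : ℕ) * averagedLaw P 0 (noRegeneration u 0 ℓ) := by
  have := hP.isProbabilityMeasure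
  have hsub : noRegeneration u k ℓ ⊆ ⋃ s ∈ Finset.range (k + 1), if s = 0 then
      noRegeneration u 0 ℓ else
      freshRecord u ∅ s ∩ future s ⁻¹' (noBacktrack u ∩ noRegeneration u 0 ℓ) := by
    intro X hX
    classical
    by_cases hex : ∃ s ≤ k, IsRegenerationTime u X s
    · obtain ⟨s₀, hs₀, hr₀⟩ := hex
      set s := Nat.findGreatest (IsRegenerationTime u X) k with hs
      have hreg : IsRegenerationTime u X s := Nat.findGreatest_spec hs₀ hr₀
      have hsk : s ≤ k := Nat.findGreatest_le k
      obtain ⟨h1, h2, h3⟩ := isRegenerationTime_iff.1 hreg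
      refine Set.mem_biUnion (x := s) (by simpa using Nat.lt_succ_of_le hsk) ?_
      rw [if_neg (by omega)]
      refine ⟨h2, h3, fun t ht htl hrt => ?_⟩
      have hst := isRegenerationTime_add hreg hrt
      by_cases hk : s + t ≤ k
      · have := Nat.le_findGreatest hk hst
        omega
      · exact hX (s + t) (by omega) (by omega) hst
    · push Not at hex
      refine Set.mem_biUnion (x := 0) (by simp) ?_
      rw [if_pos rfl]
      intro t ht htl
      by_cases htk : t ≤ k
      · exact hex t htk
      · exact hX t (by omega) (by omega)
  refine (measure_mono hsub).trans ((measure_biUnion_finset_le _ _).trans ?_)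
  refine (Finset.sum_le_card_nsmul _ _ (averagedLaw P 0 (noRegeneration u 0 ℓ))
    fun s _ => ?_).trans ?_
  · split_ifs
    · exact le_rfl
    -- Nothing is frozen here, so the environment supplied is a dummy.
    · rw [← partialLaw_empty P (fun _ => PMF.pure 0),
        hP.partialLaw_renewal _ (dependsOn_freshRecord u ∅ s) le_rfl
          ((measurableSet_noBacktrack u).inter (measurableSet_noRegeneration u 0 ℓ))
          Set.inter_subset_left, partialLaw_empty]
      exact (mul_le_of_le_one_left' prob_le_one).trans (measure_mono Set.inter_subset_right)
  · simp

/-- Markov's inequality for `τ_1`, which is at least `ℓ` on this event. -/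
lemma averagedLaw_noRegeneration_mul_le {d : ℕ} (P : Measure (Env d)) (u : Site d) {p : ℝ}
    (hp : 0 ≤ p) (ℓ : ℕ) :
    averagedLaw P 0 (noRegeneration u 0 ℓ) * (ℓ : ℝ≥0∞) ^ p ≤ regenerationMoment P u p := by
  rw [mul_comm, ← lintegral_indicator_const (measurableSet_noRegeneration u 0 ℓ)]
  refine lintegral_mono fun X => ?_
  by_cases hX : X ∈ noRegeneration u 0 ℓ
  · rw [Set.indicator_of_mem hX]
    refine ENNReal.rpow_le_rpow ?_ hp
    have : (ℓ : ℕ∞) ≤ firstRegenerationTime u X := by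
      refine le_iInf₂ fun t ht => ?_
      by_contra hlt
      exact hX t ht.1 (by simpa using (by exact_mod_cast not_le.1 hlt : t < ℓ).le) ht
    exact_mod_cast this
  · rw [Set.indicator_of_notMem hX]
    exact zero_le

/-! ### Bounded steps -/

/-- All jumps have coordinates of size at most `K`. -/
def StepsLE {d : ℕ} (K : ℕ) (ω : Env d) : Prop :=
  ∀ x y, trans ω x y ≠ 0 → ∀ i, |y i - x i| ≤ (K : ℤ)

/-- The paths from `0` with steps of size at most `K` in each coordinate. -/
def lipschitzPaths (d K : ℕ) : Set (Path d) :=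
  {X | X 0 = 0 ∧ ∀ k i, |X (k + 1) i - X k i| ≤ (K : ℤ)}

lemma lipschitzPaths_eq (d K : ℕ) : lipschitzPaths d K =
    ⋂ k, {X | X 0 = 0 ∧ ∀ i, |X (k + 1) i - X k i| ≤ (K : ℤ)} := by
  ext X
  simp only [lipschitzPaths, Set.mem_iInter, Set.mem_ofPred_eq]
  exact ⟨fun h k => ⟨h.1, h.2 k⟩, fun h => ⟨(h 0).1, fun k => (h k).2⟩⟩

lemma dependsOn_lipschitz_step (d K k : ℕ) :
    DependsOn (· ∈ {X : Path d | X 0 = 0 ∧ ∀ i, |X (k + 1) i - X k i| ≤ (K : ℤ)})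
      (Set.Iic (k + 1)) := by
  intro X Y h
  simp only [Set.mem_ofPred_eq]
  rw [h 0 (by simp), h k (by simp), h (k + 1) (by simp)]

lemma measurableSet_lipschitzPaths (d K : ℕ) : MeasurableSet (lipschitzPaths d K) := by
  rw [lipschitzPaths_eq]
  exact MeasurableSet.iInter fun k => measurableSet_of_dependsOn (dependsOn_lipschitz_step d K k)

lemma abs_sub_le_of_mem_lipschitzPaths {d K : ℕ} {X : Path d} (hX : X ∈ lipschitzPaths d K)
    (i : Fin d) {a b : ℕ} (hab : a ≤ b) : |(X b i : ℝ) - X a i| ≤ K * ((b : ℝ) - a) := by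
  induction b, hab using Nat.le_induction with
  | base => simp
  | succ b hb ih =>
    have h : |(X (b + 1) i : ℝ) - X b i| ≤ K := by exact_mod_cast hX.2 b i
    have := abs_sub_le (X (b + 1) i : ℝ) (X b i) (X a i)
    push_cast
    linarith

/-- Every cylinder in the event of an oversized `k`-th step has a zero factor in its probability or
starts away from `0`. -/
lemma ae_mem_lipschitzPaths {d K : ℕ} {ω : Env d} (hω : StepsLE K ω) :
    ∀ᵐ X ∂(quenchedLaw ω 0), X ∈ lipschitzPaths d K := by
  have : ∀ k, ∀ᵐ X ∂(quenchedLaw ω 0),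
      X ∈ {X : Path d | X 0 = 0 ∧ ∀ i, |X (k + 1) i - X k i| ≤ (K : ℤ)} := by
    intro k
    have hdep := dependsOn_lipschitz_step d K k
    refine (measure_eq_of_cyl (ν := 0) (n := k + 1) (fun X Y h => ?_) fun y hy => ?_).trans
      (Measure.coe_zero ▸ rfl)
    · exact congrArg Not (hdep h)
    · rw [quenchedLaw_cyl]
      split_ifs with h0
      · simp only [Set.mem_compl_iff, Set.mem_ofPred_eq, h0, true_and] at hy
        rw [Finset.prod_eq_zero (Finset.self_mem_range_succ k)]
        · simp
        · by_contra hne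
          exact hy (hω _ _ hne)
      · simp
  filter_upwards [ae_all_iff.2 this] with X hX
  rw [lipschitzPaths_eq]
  exact Set.mem_iInter.2 hX

/-- Shift invariance carries the bound from the origin to every site, and there are only countably
many pairs of sites. -/
lemma IsIIDProduct.exists_stepsLE {d : ℕ} {P : Measure (Env d)} (hP : IsIIDProduct P)
    (hS : HasBoundedSteps P) : ∃ K : ℕ, ∀ᵐ ω ∂P, StepsLE K ω := by
  obtain ⟨M, hM, h⟩ := hS
  refine ⟨⌈M⌉₊, ?_⟩
  have hz : ∀ z : Site d, M < ‖toE z‖ → ∀ x : Site d, ∀ᵐ ω ∂P, trans ω x (x + z) = 0 := by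
    intro z hz x
    have := (hP.measurePreserving_envShift x).quasiMeasurePreserving.ae (h z hz)
    filter_upwards [this] with ω hω
    simpa [trans_envShift] using hω
  have hall : ∀ᵐ ω ∂P, ∀ x z : Site d, M < ‖toE z‖ → trans ω x (x + z) = 0 := by
    refine ae_all_iff.2 fun x => ae_all_iff.2 fun z => ?_
    by_cases hzM : M < ‖toE z‖
    · filter_upwards [hz z hzM x] with ω hω _ using hω
    · exact Eventually.of_forall fun ω h => absurd h hzM
  filter_upwards [hall] with ω hω x y hxy i
  have hle : ‖toE (y - x)‖ ≤ M := by
    by_contra hlt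
    exact hxy (by simpa using hω x (y - x) (not_le.1 hlt))
  have h1 := PiLp.norm_apply_le (toE (y - x)) i
  have h2 : ((|y i - x i| : ℤ) : ℝ) ≤ ⌈M⌉₊ := by
    refine le_trans ?_ (h1.trans (hle.trans (Nat.le_ceil M)))
    simp [toE]
  exact_mod_cast h2

lemma ae_averagedLaw_lipschitz {d K : ℕ} {Q : Measure (Env d)} (hQ : ∀ᵐ ω ∂Q, StepsLE K ω) :
    ∀ᵐ X ∂(averagedLaw Q 0), X ∈ lipschitzPaths d K := by
  change averagedLaw Q 0 (lipschitzPaths d K)ᶜ = 0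
  rw [averagedLaw_apply _ _ (measurableSet_lipschitzPaths d K).compl]
  refine (lintegral_congr_ae ?_).trans lintegral_zero
  filter_upwards [hQ] with ω hω using ae_mem_lipschitzPaths hω

/-! ### The drift of the walk conditioned not to backtrack -/

/-- The mean of the `i`-th coordinate at time `j` of the averaged walk, conditioned on
`noBacktrack u`. -/
noncomputable def forwardMean {d : ℕ} (P : Measure (Env d)) (u : Site d) (i : Fin d) (j : ℕ) : ℝ :=
  (∫ X in noBacktrack u, (X j i : ℝ) ∂(averagedLaw P 0)) / (averagedLaw P 0).real (noBacktrack u)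

lemma measurable_coord {d : ℕ} (i : Fin d) (j : ℕ) :
    Measurable fun X : Path d => (X j i : ℝ) :=
  (measurable_of_countable (fun x : Site d => (x i : ℝ))).comp (measurable_pi_apply j)

lemma integrable_coord {d K : ℕ} {μ : Measure (Path d)} [IsFiniteMeasure μ]
    (hμ : ∀ᵐ X ∂μ, X ∈ lipschitzPaths d K) (i : Fin d) (j : ℕ) :
    Integrable (fun X : Path d => (X j i : ℝ)) μ := by
  refine Integrable.of_bound (measurable_coord i j).aestronglyMeasurable (K * j) ?_
  filter_upwards [hμ] with X hX
  simpa [hX.1] using abs_sub_le_of_mem_lipschitzPaths hX i (Nat.zero_le j)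

/-- No lower bound on the probability of `noBacktrack u` is needed: if it vanishes, both quotients
are `0` by convention. -/
lemma abs_forwardMean_sub_le {d K : ℕ} {P : Measure (Env d)} [IsProbabilityMeasure P]
    (hK : ∀ᵐ ω ∂P, StepsLE K ω) (u : Site d) (i : Fin d) {a b : ℕ} (hab : a ≤ b) :
    |forwardMean P u i b - forwardMean P u i a| ≤ K * ((b : ℝ) - a) := by
  have hl := ae_averagedLaw_lipschitz hK
  have hlr := ae_restrict_of_ae (s := noBacktrack u) hl
  rw [forwardMean, forwardMean, ← sub_div,
    ← integral_sub (integrable_coord hlr i b) (integrable_coord hlr i a)]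
  have h0 : 0 ≤ (K : ℝ) * ((b : ℝ) - a) :=
    mul_nonneg (by positivity) (sub_nonneg.2 (by exact_mod_cast hab))
  have hint : ‖∫ X in noBacktrack u, ((X b i : ℝ) - X a i) ∂(averagedLaw P 0)‖ ≤
      K * ((b : ℝ) - a) * (averagedLaw P 0).real (noBacktrack u) := by
    refine norm_setIntegral_le_of_norm_le_const_ae' (measure_lt_top _ _) ?_
    filter_upwards [hl] with X hX _ using abs_sub_le_of_mem_lipschitzPaths hX i hab
  rw [abs_div, abs_of_nonneg (measureReal_nonneg (s := noBacktrack u))]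
  exact div_le_of_le_mul₀ measureReal_nonneg h0 hint

/-- By renewal, the future after `t` on this event is distributed as a multiple of the averaged walk
restricted to `noBacktrack u`. Subtracting `forwardMean` is exactly the centring of that law. -/
lemma IsIIDProduct.setIntegral_renewal_eq_zero {d K : ℕ} {P : Measure (Env d)}
    (hP : IsIIDProduct P) (hK : ∀ᵐ ω ∂P, StepsLE K ω) {u : Site d} {T : Set (Site d)} (ω : Env d)
    {t n : ℕ} (htn : t ≤ n) {A : Set (Path d)} (hA : DependsOn (· ∈ A) (Set.Iic t))
    (hAT : A ⊆ freshRecord u T t) (i : Fin d) :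
    ∫ X in A ∩ future t ⁻¹' noBacktrack u,
      ((X n i : ℝ) - X t i - forwardMean P u i (n - t)) ∂(partialLaw P T ω) = 0 := by
  have := hP.isProbabilityMeasure
  have hAm := measurableSet_of_dependsOn hA
  have hD := measurableSet_noBacktrack u
  have hfD := measurable_future t hD
  have hmeas : (((partialLaw P T ω).restrict (A ∩ future t ⁻¹' noBacktrack u)).map (future t)) =
      partialLaw P T ω A • (averagedLaw P 0).restrict (noBacktrack u) := by
    refine Measure.ext fun B hB => ?_
    rw [Measure.map_apply (measurable_future t) hB, Measure.smul_apply, smul_eq_mul,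
      Measure.restrict_apply (measurable_future t hB), Measure.restrict_apply hB,
      ← hP.partialLaw_renewal ω hA hAT (hB.inter hD) Set.inter_subset_right]
    congr 1
    ext X
    simp only [Set.mem_inter_iff, Set.mem_preimage]
    tauto
  have hφ : Measurable fun Y : Path d => (Y (n - t) i : ℝ) - forwardMean P u i (n - t) :=
    (measurable_coord i _).sub_const _
  have hrw : ∀ X : Path d, (X n i : ℝ) - X t i - forwardMean P u i (n - t) =
      (fun Y : Path d => (Y (n - t) i : ℝ) - forwardMean P u i (n - t)) (future t X) := by
    intro X
    simp [future, show t + (n - t) = n by omega]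
  simp_rw [hrw]
  rw [← integral_map (measurable_future t).aemeasurable hφ.aestronglyMeasurable, hmeas,
    integral_smul_measure, integral_sub (integrable_coord
      (ae_restrict_of_ae (ae_averagedLaw_lipschitz hK)) i _) (integrable_const _),
    setIntegral_const, forwardMean, smul_eq_mul, smul_eq_mul]
  -- If backtracking is almost sure, the set of integration is null and the junk value of
  -- `forwardMean` is harmless.
  by_cases h0 : (averagedLaw P 0).real (noBacktrack u) = 0
  · rw [setIntegral_measure_zero _ ((measureReal_eq_zero_iff).1 h0), h0]
    simp
  · rw [mul_div_cancel₀ _ h0, sub_self, mul_zero]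

/-! ### The effect of a single site on the partially averaged walk -/

/-- The paths that visit `z` at time `k` for the first time. -/
def firstHit {d : ℕ} (z : Site d) (k : ℕ) : Set (Path d) := {X | X k = z ∧ ∀ j < k, X j ≠ z}

lemma dependsOn_firstHit {d : ℕ} (z : Site d) (k : ℕ) :
    DependsOn (· ∈ firstHit z k) (Set.Iic k) := by
  intro X Y h
  refine propext (and_congr ?_ (forall₂_congr fun j hj => ?_))
  · rw [h k (Set.mem_Iic.2 le_rfl)]
  · rw [h j hj.le]

lemma measurableSet_firstHit {d : ℕ} (z : Site d) (k : ℕ) : MeasurableSet (firstHit z k) :=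
  measurableSet_of_dependsOn (dependsOn_firstHit z k)

/-- The paths whose first regeneration time after `k` is `t`. -/
def nextRegeneration {d : ℕ} (u : Site d) (k t : ℕ) : Set (Path d) :=
  {X | IsRegenerationTime u X t ∧ ∀ s, k < s → s < t → ¬ IsRegenerationTime u X s}

/-- Once `t` is known to be a regeneration time, whether an earlier `s` is one is decided by the
path up to `t`. This lets "`t` is the first regeneration after `k`" split into past and future. -/
lemma isRegenerationTime_iff_of_lt {d : ℕ} {u : Site d} {X : Path d} {s t : ℕ} (hst : s < t)
    (ht : future t X ∈ noBacktrack u) (ht' : X ∈ freshRecord u ∅ t) :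
    IsRegenerationTime u X s ↔ 1 ≤ s ∧ X ∈ freshRecord u ∅ s ∧
      ∀ r, s ≤ r → r ≤ t → X s ⬝ᵥ u ≤ X r ⬝ᵥ u := by
  have hreg : IsRegenerationTime u X t := isRegenerationTime_iff.2 ⟨by omega, ht', ht⟩
  constructor
  · intro h
    exact ⟨h.1, (isRegenerationTime_iff.1 h).2.1, fun r hr _ => h.2.2 r hr⟩
  · rintro ⟨h1, h2, h3⟩
    refine ⟨h1, h2.1, fun r hr => ?_⟩
    by_cases hrt : r ≤ t
    · exact h3 r hr hrt
    · exact (hreg.2.1 s hst).le.trans (hreg.2.2 r (by omega))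

/-- A strict record at `t > k` lies above `X k = z`, hence above all of `T`. So the event has the
product form to which renewal applies with `T` frozen. -/
lemma firstHit_inter_nextRegeneration {d : ℕ} {u z : Site d} {T : Set (Site d)}
    (hT : ∀ x ∈ T, x ⬝ᵥ u ≤ z ⬝ᵥ u) {k t : ℕ} (hkt : k < t) :
    firstHit z k ∩ nextRegeneration u k t =
      (firstHit z k ∩ freshRecord u T t ∩ {X | ∀ s, k < s → s < t →
        ¬ (1 ≤ s ∧ X ∈ freshRecord u ∅ s ∧ ∀ r, s ≤ r → r ≤ t → X s ⬝ᵥ u ≤ X r ⬝ᵥ u)}) ∩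
      future t ⁻¹' noBacktrack u := by
  ext X
  constructor
  · rintro ⟨hk, hreg, hno⟩
    obtain ⟨h1, h2, h3⟩ := isRegenerationTime_iff.1 hreg
    refine ⟨⟨⟨hk, h2.1, fun x hx => ?_⟩, fun s hs hst => ?_⟩, h3⟩
    · exact (hT x hx).trans_lt (hk.1 ▸ h2.1 k hkt)
    · rw [← isRegenerationTime_iff_of_lt hst h3 h2]
      exact hno s hs hst
  · rintro ⟨⟨⟨hk, h2⟩, hno⟩, h3⟩
    have h2' : X ∈ freshRecord u ∅ t := ⟨h2.1, fun x hx => absurd hx (Set.notMem_empty x)⟩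
    refine ⟨hk, isRegenerationTime_iff.2 ⟨by omega, h2', h3⟩, fun s hs hst => ?_⟩
    rw [isRegenerationTime_iff_of_lt hst h3 h2']
    exact hno s hs hst

lemma IsIIDProduct.setIntegral_nextRegeneration_eq_zero {d K : ℕ} {P : Measure (Env d)}
    (hP : IsIIDProduct P) (hK : ∀ᵐ ω ∂P, StepsLE K ω) {u z : Site d} {T : Set (Site d)}
    (hT : ∀ x ∈ T, x ⬝ᵥ u ≤ z ⬝ᵥ u) (ω : Env d) {k t n : ℕ} (hkt : k < t) (htn : t ≤ n)
    (i : Fin d) :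
    ∫ X in firstHit z k ∩ nextRegeneration u k t,
      ((X n i : ℝ) - X t i - forwardMean P u i (n - t)) ∂(partialLaw P T ω) = 0 := by
  rw [firstHit_inter_nextRegeneration hT hkt]
  refine hP.setIntegral_renewal_eq_zero hK ω htn (dependsOn_mem_inter (dependsOn_mem_inter
    (fun X Y h => dependsOn_firstHit z k fun j hj => h j ?_) (dependsOn_freshRecord u T t))
    fun X Y h => ?_) (fun X hX => hX.1.2) i
  · simp only [Set.mem_Iic] at hj ⊢
    omega
  · refine propext (forall_congr' fun s => forall₂_congr fun hs hst => not_congr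
      (and_congr_right fun _ => and_congr ?_ ?_))
    · refine (dependsOn_freshRecord u ∅ s fun j hj => h j ?_).to_iff
      simp only [Set.mem_Iic] at hj ⊢
      omega
    · refine forall_congr' fun r => forall₂_congr fun _ hr => ?_
      rw [h s hst.le, h r hr]

lemma measurableSet_nextRegeneration {d : ℕ} (u : Site d) (k t : ℕ) :
    MeasurableSet (nextRegeneration u k t) := by
  have : nextRegeneration u k t = {X | IsRegenerationTime u X t} ∩
      ⋂ s ∈ Finset.Ioo k t, {X : Path d | IsRegenerationTime u X s}ᶜ := by
    ext X
    simp [nextRegeneration]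
  rw [this]
  exact (measurableSet_isRegenerationTime u t).inter
    (Finset.measurableSet_biInter _ fun s _ => (measurableSet_isRegenerationTime u s).compl)

lemma forwardMean_zero {d K : ℕ} {P : Measure (Env d)} (hK : ∀ᵐ ω ∂P, StepsLE K ω) (u : Site d)
    (i : Fin d) : forwardMean P u i 0 = 0 := by
  rw [forwardMean, integral_eq_zero_of_ae, zero_div]
  filter_upwards [ae_restrict_of_ae (ae_averagedLaw_lipschitz hK)] with X hX
  simp [hX.1]

/-- The deviation of the walk from its conditioned mean after hitting `z`, corrected by the part
that has mean zero by renewal, is controlled by the time until the next regeneration. -/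
lemma abs_sub_sum_indicator_le {d K : ℕ} {u z : Site d} {m : ℕ → ℝ} (hm0 : m 0 = 0)
    (hm : ∀ a b : ℕ, a ≤ b → |m b - m a| ≤ K * ((b : ℝ) - a)) {X : Path d}
    (hX : X ∈ lipschitzPaths d K) {k n : ℕ} (hkn : k ≤ n) (ℓ : ℕ) (i : Fin d) :
    |(firstHit z k).indicator (fun X => (X n i : ℝ) - z i - m (n - k)) X -
      ∑ t ∈ Finset.Ioc k n, (firstHit z k ∩ nextRegeneration u k t).indicator
        (fun X => (X n i : ℝ) - X t i - m (n - t)) X| ≤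
      2 * K * (ℓ * (firstHit z k).indicator 1 X +
        n * (firstHit z k ∩ noRegeneration u k ℓ).indicator 1 X) := by
  have hKℓ : (0 : ℝ) ≤ K * ℓ := by positivity
  have hKn : (0 : ℝ) ≤ K * n := by positivity
  have hkn' : (k : ℝ) ≤ n := by exact_mod_cast hkn
  by_cases hE : X ∈ firstHit z k
  swap
  · have h1 : ∀ B : Set (Path d), X ∉ firstHit z k ∩ B := fun B h => hE h.1
    rw [Finset.sum_eq_zero fun t _ => Set.indicator_of_notMem (h1 _) _,
      Set.indicator_of_notMem hE, Set.indicator_of_notMem hE, Set.indicator_of_notMem (h1 _)]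
    simp
  simp only [Set.indicator_of_mem hE, Pi.one_apply, mul_one]
  -- `t` is the next regeneration time, or `n` if there is none up to time `n`
  have key : ∀ t : ℕ, k ≤ t → t ≤ n → (k + ℓ < t → X ∈ noRegeneration u k ℓ) →
      |((X n i : ℝ) - z i - m (n - k)) - ((X n i : ℝ) - X t i - m (n - t))| ≤
      2 * K * (ℓ + n * (firstHit z k ∩ noRegeneration u k ℓ).indicator 1 X) := by
    intro t hkt htn hno
    have h1 := abs_sub_le_of_mem_lipschitzPaths hX i hkt
    have h2 := hm (n - t) (n - k) (by omega)
    rw [Nat.cast_sub htn, Nat.cast_sub hkn] at h2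
    rw [← hE.1]
    have h3 : |((X n i : ℝ) - X k i - m (n - k)) - ((X n i : ℝ) - X t i - m (n - t))| ≤
        2 * K * ((t : ℝ) - k) := by
      rw [show ((X n i : ℝ) - X k i - m (n - k)) - ((X n i : ℝ) - X t i - m (n - t)) =
        ((X t i : ℝ) - X k i) - (m (n - k) - m (n - t)) by ring]
      refine (abs_sub _ _).trans ?_
      linarith
    refine h3.trans (mul_le_mul_of_nonneg_left ?_ (by positivity))
    by_cases hlt : k + ℓ < t
    · rw [Set.indicator_of_mem (show X ∈ firstHit (X k) k ∩ noRegeneration u k ℓ from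
        ⟨by simpa [hE.1] using hE, hno hlt⟩), Pi.one_apply]
      have h4 : (t : ℝ) ≤ n := by exact_mod_cast htn
      have h5 : (0 : ℝ) ≤ k := by positivity
      have h6 : (0 : ℝ) ≤ ℓ := by positivity
      linarith
    · have h4 : (t : ℝ) ≤ k + ℓ := by exact_mod_cast not_lt.1 hlt
      have h5 : (0 : ℝ) ≤ n * (firstHit (X k) k ∩ noRegeneration u k ℓ).indicator 1 X :=
        mul_nonneg (by positivity) (Set.indicator_nonneg (fun _ _ => zero_le_one) _)
      linarith
  classical
  by_cases hex : ∃ t, k < t ∧ t ≤ n ∧ IsRegenerationTime u X t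
  · set t := Nat.find hex
    obtain ⟨hkt, htn, hreg⟩ : k < t ∧ t ≤ n ∧ IsRegenerationTime u X t := Nat.find_spec hex
    have hmin : ∀ s, k < s → s < t → ¬ IsRegenerationTime u X s := fun s hs hst hr =>
      Nat.find_min hex hst ⟨hs, hst.le.trans htn, hr⟩
    rw [Finset.sum_eq_single_of_mem t (Finset.mem_Ioc.2 ⟨hkt, htn⟩),
      Set.indicator_of_mem (show X ∈ firstHit z k ∩ nextRegeneration u k t from ⟨hE, hreg, hmin⟩)]
    · exact key t hkt.le htn fun hlt s hs hsl => hmin s hs (by omega)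
    · intro s hs hne
      refine Set.indicator_of_notMem (fun h => ?_) _
      rcases lt_or_gt_of_ne hne with hlt | hgt
      · exact hmin s (Finset.mem_Ioc.1 hs).1 hlt h.2.1
      · exact h.2.2 t hkt hgt hreg
  · rw [Finset.sum_eq_zero fun t ht => Set.indicator_of_notMem (fun h => hex
      ⟨t, (Finset.mem_Ioc.1 ht).1, (Finset.mem_Ioc.1 ht).2, h.2.1⟩) _]
    -- For `t = n` the correction term is `X n - X n - m 0`, which vanishes by `hm0`.
    have := key n hkn le_rfl fun hlt s hs hsl hr => hex ⟨s, hs, by omega, hr⟩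
    simpa [hm0] using this

lemma ae_map_stepsLE {d K : ℕ} {P : Measure (Env d)} {T : Set (Site d)} {ω : Env d}
    (hω : ∀ᵐ ω' ∂P, StepsLE K (merge T ω ω')) : ∀ᵐ ω' ∂(P.map (merge T ω)), StepsLE K ω' := by
  have hset : {ω | StepsLE K ω} = ⋂ x : Site d, ⋂ y : Site d,
      {ω : Env d | trans ω x y ≠ 0}ᶜ ∪ {_ω | ∀ i, |y i - x i| ≤ (K : ℤ)} := by
    ext ω
    simp only [StepsLE, imp_iff_not_or, Set.mem_ofPred_eq, Set.mem_iInter, Set.mem_union,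
      Set.mem_compl_iff]
  refine (ae_map_iff (measurable_merge_right T ω).aemeasurable ?_).2 hω
  rw [hset]
  refine MeasurableSet.iInter fun x => MeasurableSet.iInter fun y =>
    MeasurableSet.union ?_ (MeasurableSet.const _)
  exact (measurable_trans x y (measurableSet_singleton 0)).compl.compl

/-- Subtract the renewal terms over the possible next regeneration times `t`, which integrate to
zero. What remains is the displacement and the change of `forwardMean` over the gap alone. -/
lemma IsIIDProduct.abs_setIntegral_firstHit_le {d K : ℕ} {P : Measure (Env d)}
    (hP : IsIIDProduct P) (hK : ∀ᵐ ω ∂P, StepsLE K ω) {u z : Site d} {T : Set (Site d)}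
    (hT : ∀ x ∈ T, x ⬝ᵥ u ≤ z ⬝ᵥ u) {ω : Env d} (hω : ∀ᵐ ω' ∂P, StepsLE K (merge T ω ω'))
    {k n : ℕ} (hkn : k ≤ n) (ℓ : ℕ) (i : Fin d) :
    |∫ X in firstHit z k, ((X n i : ℝ) - z i - forwardMean P u i (n - k)) ∂(partialLaw P T ω)| ≤
      2 * K * (ℓ * (partialLaw P T ω).real (firstHit z k) +
        n * (partialLaw P T ω).real (firstHit z k ∩ noRegeneration u k ℓ)) := by
  have := hP.isProbabilityMeasure
  set μ := partialLaw P T ω with hμ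
  have hl : ∀ᵐ X ∂μ, X ∈ lipschitzPaths d K := ae_averagedLaw_lipschitz (ae_map_stepsLE hω)
  have hc := fun j => integrable_coord hl i j
  have hEm := measurableSet_firstHit z k
  have hGm := hEm.inter (measurableSet_noRegeneration u k ℓ)
  have hRm := fun t => hEm.inter (measurableSet_nextRegeneration u k t)
  have hi1 : Integrable ((firstHit z k).indicator
      fun X => (X n i : ℝ) - z i - forwardMean P u i (n - k)) μ :=
    (((hc n).sub (integrable_const _)).sub (integrable_const _)).indicator hEm
  have hi2 : ∀ t, Integrable ((firstHit z k ∩ nextRegeneration u k t).indicator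
      fun X => (X n i : ℝ) - X t i - forwardMean P u i (n - t)) μ := fun t =>
    (((hc n).sub (hc t)).sub (integrable_const _)).indicator (hRm t)
  have hi3 : Integrable ((firstHit z k).indicator (1 : Path d → ℝ)) μ :=
    (integrable_const (1 : ℝ)).indicator hEm
  have hi4 : Integrable ((firstHit z k ∩ noRegeneration u k ℓ).indicator (1 : Path d → ℝ)) μ :=
    (integrable_const (1 : ℝ)).indicator hGm
  have hzero : ∫ X, ∑ t ∈ Finset.Ioc k n, (firstHit z k ∩ nextRegeneration u k t).indicator
      (fun X => (X n i : ℝ) - X t i - forwardMean P u i (n - t)) X ∂μ = 0 := by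
    rw [integral_finsetSum _ fun t _ => hi2 t]
    refine Finset.sum_eq_zero fun t ht => ?_
    rw [integral_indicator (hRm t)]
    exact hP.setIntegral_nextRegeneration_eq_zero hK hT ω (Finset.mem_Ioc.1 ht).1
      (Finset.mem_Ioc.1 ht).2 i
  have hsub := integral_sub hi1 (integrable_finsetSum (Finset.Ioc k n) fun t _ => hi2 t)
  rw [hzero, sub_zero] at hsub
  rw [← integral_indicator hEm, ← hsub, ← integral_indicator_one hEm,
    ← integral_indicator_one hGm, ← integral_const_mul, ← integral_const_mul,
    ← integral_add (hi3.const_mul _) (hi4.const_mul _), ← integral_const_mul, ← Real.norm_eq_abs]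
  refine norm_integral_le_of_norm_le (((hi3.const_mul _).add (hi4.const_mul _)).const_mul _) ?_
  filter_upwards [hl] with X hX
  exact abs_sub_sum_indicator_le (forwardMean_zero hK u i)
    (fun a b hab => abs_forwardMean_sub_le hK u i hab) hX hkn ℓ i

/-! ### Averaging over part of the environment -/

/-- The conditional expectation of `f` given the environment on `T`. -/
noncomputable def partialMean {d : ℕ} (P : Measure (Env d)) (T : Set (Site d)) (f : Env d → ℝ)
    (ω : Env d) : ℝ := ∫ ω', f (merge T ω ω') ∂P

lemma measurable_partialMean {d : ℕ} (P : Measure (Env d)) [IsProbabilityMeasure P]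
    (T : Set (Site d)) {f : Env d → ℝ} (hf : Measurable f) : Measurable (partialMean P T f) :=
  (StronglyMeasurable.integral_prod_right'
    (f := fun p : Env d × Env d => f (merge T p.1 p.2))
    (hf.comp (measurable_merge T)).stronglyMeasurable).measurable

lemma abs_partialMean_le {d : ℕ} (P : Measure (Env d)) [IsProbabilityMeasure P]
    (T : Set (Site d)) {f : Env d → ℝ} {C : ℝ} (hC : ∀ ω, |f ω| ≤ C) (ω : Env d) :
    |partialMean P T f ω| ≤ C := by
  have := norm_integral_le_of_norm_le_const (μ := P) (f := fun ω' => f (merge T ω ω'))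
    (Eventually.of_forall fun ω' => hC _)
  simpa [partialMean] using this

lemma dependsOn_partialMean {d : ℕ} (P : Measure (Env d)) {S T U : Set (Site d)} {f : Env d → ℝ}
    (hf : DependsOn f U) (hST : T ∩ U ⊆ S) : DependsOn (partialMean P T f) S := by
  intro ω₁ ω₂ h
  refine integral_congr_ae (Eventually.of_forall fun ω' => hf fun x hx => ?_)
  by_cases hxT : x ∈ T
  · rw [merge_of_mem hxT, merge_of_mem hxT, h x (hST ⟨hxT, hx⟩)]
  · rw [merge_of_notMem hxT, merge_of_notMem hxT]

lemma integrable_of_abs_le {α : Type*} [MeasurableSpace α] {μ : Measure α} [IsFiniteMeasure μ]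
    {f : α → ℝ} (hf : Measurable f) {C : ℝ} (hC : ∀ x, |f x| ≤ C) : Integrable f μ :=
  Integrable.of_bound hf.aestronglyMeasurable C (Eventually.of_forall hC)

lemma abs_mul_le_mul {a b C C' : ℝ} (ha : |a| ≤ C) (hb : |b| ≤ C') : |a * b| ≤ C * C' := by
  rw [abs_mul]
  exact mul_le_mul ha hb (abs_nonneg b) ((abs_nonneg a).trans ha)

lemma integrable_sq_of_abs_le {α : Type*} [MeasurableSpace α] {μ : Measure α} [IsFiniteMeasure μ]
    {f : α → ℝ} (hf : Measurable f) {C : ℝ} (hC : ∀ x, |f x| ≤ C) :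
    Integrable (fun x => f x ^ 2) μ :=
  integrable_of_abs_le (hf.pow_const 2) (C := C * C) fun x => by
    rw [pow_two]
    exact abs_mul_le_mul (hC x) (hC x)

/-- The defining property of conditional expectation, from `IsIIDProduct.measurePreserving_merge`
and Fubini. -/
lemma IsIIDProduct.integral_mul_partialMean {d : ℕ} {P : Measure (Env d)} (hP : IsIIDProduct P)
    {T : Set (Site d)} {f h : Env d → ℝ} (hf : Measurable f) (hh : Measurable h) {C C' : ℝ}
    (hC : ∀ ω, |f ω| ≤ C) (hC' : ∀ ω, |h ω| ≤ C') (hT : DependsOn h T) :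
    ∫ ω, h ω * partialMean P T f ω ∂P = ∫ ω, h ω * f ω ∂P := by
  have := hP.isProbabilityMeasure
  have hmp := hP.measurePreserving_merge T
  have hm : Measurable fun p : Env d × Env d => h (merge T p.1 p.2) * f (merge T p.1 p.2) :=
    (hh.comp (measurable_merge T)).mul (hf.comp (measurable_merge T))
  conv_rhs => rw [← hmp.map_eq]
  rw [integral_map (f := fun ω => h ω * f ω) hmp.measurable.aemeasurable
    (hh.mul hf).aestronglyMeasurable,
    integral_prod _ (integrable_of_abs_le hm fun p => abs_mul_le_mul (hC' _) (hC _))]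
  refine integral_congr_ae (Eventually.of_forall fun ω => ?_)
  simp only [partialMean]
  rw [← integral_const_mul]
  refine integral_congr_ae (Eventually.of_forall fun ω' => ?_)
  exact congrArg (· * f (merge T ω ω')) (hT fun x hx => (merge_of_mem hx _ _).symm)

lemma IsIIDProduct.integral_partialMean {d : ℕ} {P : Measure (Env d)} (hP : IsIIDProduct P)
    (T : Set (Site d)) {f : Env d → ℝ} (hf : Measurable f) {C : ℝ} (hC : ∀ ω, |f ω| ≤ C) :
    ∫ ω, partialMean P T f ω ∂P = ∫ ω, f ω ∂P := by
  simpa using hP.integral_mul_partialMean (T := T) (h := fun _ => 1) hf measurable_const hC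
    (C' := 1) (by simp) fun _ _ _ => rfl

lemma integral_sq_sub {α : Type*} [MeasurableSpace α] {μ : Measure α} [IsFiniteMeasure μ]
    {f g : α → ℝ} (hf : Measurable f) (hg : Measurable g) {C C' : ℝ} (hC : ∀ x, |f x| ≤ C)
    (hC' : ∀ x, |g x| ≤ C') :
    ∫ x, (f x - g x) ^ 2 ∂μ = ∫ x, f x ^ 2 ∂μ - 2 * ∫ x, g x * f x ∂μ + ∫ x, g x ^ 2 ∂μ := by
  have h1 : Integrable (fun x => f x ^ 2) μ := integrable_sq_of_abs_le hf hC
  have h2 : Integrable (fun x => g x ^ 2) μ := integrable_sq_of_abs_le hg hC'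
  have h3 : Integrable (fun x => g x * f x) μ := integrable_of_abs_le (hg.mul hf)
    fun x => abs_mul_le_mul (hC' x) (hC x)
  have h4 : Integrable (fun x => f x ^ 2 - 2 * (g x * f x)) μ := h1.sub (h3.const_mul 2)
  rw [← integral_const_mul, ← integral_sub h1 (h3.const_mul 2), ← integral_add h4 h2]
  refine integral_congr_ae (Eventually.of_forall fun x => ?_)
  simp only
  ring

lemma IsIIDProduct.integral_sq_partialMean_le {d : ℕ} {P : Measure (Env d)} (hP : IsIIDProduct P)
    (T : Set (Site d)) {f : Env d → ℝ} (hf : Measurable f) {C : ℝ} (hC : ∀ ω, |f ω| ≤ C) :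
    ∫ ω, partialMean P T f ω ^ 2 ∂P ≤ ∫ ω, f ω ^ 2 ∂P := by
  have := hP.isProbabilityMeasure
  have hm := measurable_partialMean P T hf
  have hb := abs_partialMean_le P T hC
  have h1 := integral_sq_sub (μ := P) hf hm hC hb
  have h2 := hP.integral_mul_partialMean hf hm hC hb
    (dependsOn_partialMean P (dependsOn_univ f) Set.inter_subset_left)
  simp only [← pow_two] at h2
  have h3 : 0 ≤ ∫ ω, (f ω - partialMean P T f ω) ^ 2 ∂P := integral_nonneg fun ω => sq_nonneg _
  linarith

/-- Expanding the squared distance to `c` for `T` and for `S` gives the same cross term, the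
integral of `c * f`. The difference is then the left side, and the squared distance for `S` is
nonnegative. -/
lemma IsIIDProduct.integral_sq_partialMean_sub_le {d : ℕ} {P : Measure (Env d)}
    (hP : IsIIDProduct P) {S T : Set (Site d)} (hST : S ⊆ T) {f c : Env d → ℝ}
    (hf : Measurable f) (hc : Measurable c) {C C' : ℝ} (hC : ∀ ω, |f ω| ≤ C)
    (hC' : ∀ ω, |c ω| ≤ C') (hcS : DependsOn c S) :
    ∫ ω, partialMean P T f ω ^ 2 ∂P - ∫ ω, partialMean P S f ω ^ 2 ∂P ≤
      ∫ ω, (partialMean P T f ω - c ω) ^ 2 ∂P := by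
  have := hP.isProbabilityMeasure
  rw [integral_sq_sub (measurable_partialMean P T hf) hc (abs_partialMean_le P T hC) hC',
    hP.integral_mul_partialMean hf hc hC hC' (hcS.mono hST)]
  have h1 := integral_sq_sub (μ := P) (measurable_partialMean P S hf) hc
    (abs_partialMean_le P S hC) hC'
  rw [hP.integral_mul_partialMean hf hc hC hC' hcS] at h1
  have h3 : 0 ≤ ∫ ω, (partialMean P S f ω - c ω) ^ 2 ∂P := integral_nonneg fun ω => sq_nonneg _
  linarith

/-- The variance of a function of finitely many sites, exposed in the order of a level function,
is bounded by the sum of the squared influences of the sites. -/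
lemma IsIIDProduct.variance_le_sum {d : ℕ} {P : Measure (Env d)} (hP : IsIIDProduct P)
    (u : Site d) {B : Finset (Site d)} {f : Env d → ℝ} (hf : Measurable f) {C : ℝ}
    (hC : ∀ ω, |f ω| ≤ C) (hfB : DependsOn f (B : Set (Site d))) {b : Site d → ℝ}
    (hb : ∀ z : Site d, ∀ S : Set (Site d), (∀ x ∈ S, x ⬝ᵥ u ≤ z ⬝ᵥ u) → ∃ c : Env d → ℝ,
      Measurable c ∧ (∃ C', ∀ ω, |c ω| ≤ C') ∧ DependsOn c S ∧
        ∫ ω, (partialMean P (insert z S) f ω - c ω) ^ 2 ∂P ≤ b z) :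
    ∫ ω, (f ω - ∫ ω', f ω' ∂P) ^ 2 ∂P ≤ ∑ z ∈ B, b z := by
  classical
  have := hP.isProbabilityMeasure
  have hstep : ∀ B' : Finset (Site d), ∫ ω, partialMean P B' f ω ^ 2 ∂P -
      (∫ ω, f ω ∂P) ^ 2 ≤ ∑ z ∈ B', b z := by
    intro B'
    -- Each new site has maximal level, so all sites exposed before it satisfy the level condition
    -- in `hb`.
    induction B' using Finset.induction_on_max_value (fun x : Site d => x ⬝ᵥ u) with
    | empty =>
      have : ∀ ω, partialMean P ∅ f ω = ∫ ω, f ω ∂P := fun ω => by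
        refine integral_congr_ae (Eventually.of_forall fun ω' => congrArg f ?_)
        funext x
        exact merge_of_notMem (Set.notMem_empty x) _ _
      simp [this]
    | insert z S hz hmax ih =>
      obtain ⟨c, hc, ⟨C', hC'⟩, hcS, hle⟩ := hb z S hmax
      have := hP.integral_sq_partialMean_sub_le (Set.subset_insert z (S : Set (Site d))) hf hc hC
        hC' hcS
      rw [Finset.sum_insert hz, Finset.coe_insert]
      linarith
  have hB : ∀ ω, partialMean P B f ω = f ω := fun ω => by
    have : ∀ ω', f (merge B ω ω') = f ω := fun ω' => hfB fun x hx => merge_of_mem hx _ _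
    simp [partialMean, this]
  have h1 := hstep B
  simp only [hB] at h1
  rw [integral_sq_sub hf measurable_const hC (C' := |∫ ω, f ω ∂P|) (fun _ => le_rfl),
    integral_const_mul, integral_const]
  simp only [probReal_univ, smul_eq_mul, one_mul]
  linarith

/-! ### Quenched means and hitting probabilities as functions of the environment -/

lemma integral_bind_kernel {α β : Type*} [MeasurableSpace α] [MeasurableSpace β] {μ : Measure α}
    {κ : Kernel α β} {f : β → ℝ} (hf : Integrable f (μ.bind κ)) :
    ∫ y, f y ∂(μ.bind κ) = ∫ x, ∫ y, f y ∂(κ x) ∂μ := by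
  have h := Kernel.integral_comp (η := κ) (κ := Kernel.const Unit μ) (a := ()) (f := f)
  simp only [Kernel.comp_apply, Kernel.const_apply] at h
  exact h hf

lemma integral_partialLaw {d : ℕ} (P : Measure (Env d)) (T : Set (Site d)) (ω : Env d)
    {Φ : Path d → ℝ} (hΦ : Measurable Φ) (hi : Integrable Φ (partialLaw P T ω)) :
    ∫ X, Φ X ∂(partialLaw P T ω) = ∫ ω', ∫ X, Φ X ∂(quenchedLaw (merge T ω ω') 0) ∂P := by
  rw [partialLaw, averagedLaw, integral_bind_kernel hi, integral_map
    (measurable_merge_right T ω).aemeasurable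
    (hΦ.stronglyMeasurable.integral_kernel).aestronglyMeasurable]
  rfl

lemma measurable_quenchedLaw_real {d : ℕ} {A : Set (Path d)} (hA : MeasurableSet A) :
    Measurable fun ω : Env d => (quenchedLaw ω 0).real A :=
  (measurable_quenchedLaw_apply 0 hA).ennreal_toReal

lemma abs_real_le_one {α : Type*} [MeasurableSpace α] (μ : Measure α) [IsProbabilityMeasure μ]
    (A : Set α) : |μ.real A| ≤ 1 := by
  rw [abs_of_nonneg measureReal_nonneg]
  exact measureReal_le_one

lemma partialLaw_real {d : ℕ} (P : Measure (Env d)) (T : Set (Site d)) (ω : Env d)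
    {A : Set (Path d)} (hA : MeasurableSet A) :
    (partialLaw P T ω).real A = partialMean P T (fun ω => (quenchedLaw ω 0).real A) ω := by
  rw [measureReal_def, partialLaw_apply _ _ _ hA, partialMean, ← integral_toReal
    (f := fun ω' => quenchedLaw (merge T ω ω') 0 A)
    ((measurable_quenchedLaw_apply 0 hA).comp (measurable_merge_right T ω)).aemeasurable
    (Eventually.of_forall fun _ => measure_lt_top _ _)]
  rfl

lemma averagedLaw_real {d : ℕ} (P : Measure (Env d)) {A : Set (Path d)} (hA : MeasurableSet A) :
    (averagedLaw P 0).real A = ∫ ω, (quenchedLaw ω 0).real A ∂P := by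
  rw [measureReal_def, averagedLaw_apply _ _ hA, ← integral_toReal
    (measurable_quenchedLaw_apply 0 hA).aemeasurable
    (Eventually.of_forall fun _ => measure_lt_top _ _)]
  rfl

/-- The paths that do not visit `z` before time `n`. -/
def avoids {d : ℕ} (z : Site d) (n : ℕ) : Set (Path d) := {X | ∀ k < n, X k ≠ z}

/-- The paths that stay in `B` up to time `n`. -/
def confined {d : ℕ} (B : Finset (Site d)) (n : ℕ) : Set (Path d) := {X | ∀ k ≤ n, X k ∈ B}

lemma dependsOn_avoids {d : ℕ} (z : Site d) (n : ℕ) : DependsOn (· ∈ avoids z n) (Set.Iic n) := by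
  intro X Y h
  refine propext (forall₂_congr fun k hk => ?_)
  rw [h k hk.le]

lemma dependsOn_confined {d : ℕ} (B : Finset (Site d)) (n : ℕ) :
    DependsOn (· ∈ confined B n) (Set.Iic n) := by
  intro X Y h
  refine propext (forall₂_congr fun k hk => ?_)
  rw [h k hk]

lemma measurableSet_avoids {d : ℕ} (z : Site d) (n : ℕ) : MeasurableSet (avoids z n) :=
  measurableSet_of_dependsOn (dependsOn_avoids z n)

lemma measurableSet_confined {d : ℕ} (B : Finset (Site d)) (n : ℕ) :
    MeasurableSet (confined B n) :=
  measurableSet_of_dependsOn (dependsOn_confined B n)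

/-- A path that visits `z` before time `n` has exactly one first hitting time. -/
lemma indicator_avoids_compl {d : ℕ} (z : Site d) (n : ℕ) (X : Path d) :
    (avoids z n)ᶜ.indicator (1 : Path d → ℝ) X =
      ∑ k ∈ Finset.range n, (firstHit z k).indicator 1 X := by
  classical
  by_cases hX : X ∈ avoids z n
  · rw [Set.indicator_of_notMem (by simpa using hX)]
    exact (Finset.sum_eq_zero fun k hk => Set.indicator_of_notMem
      (fun h => hX k (Finset.mem_range.1 hk) h.1) _).symm
  · have hex : ∃ k, k < n ∧ X k = z := by
      simpa [avoids] using hX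
    obtain ⟨hk, hkz⟩ := Nat.find_spec hex
    have hmin : ∀ j < Nat.find hex, X j ≠ z := fun j hj hjz =>
      Nat.find_min hex hj ⟨hj.trans hk, hjz⟩
    rw [Set.indicator_of_mem (by simpa using hX), Finset.sum_eq_single_of_mem (Nat.find hex)
      (Finset.mem_range.2 hk), Set.indicator_of_mem (show X ∈ firstHit z _ from ⟨hkz, hmin⟩)]
    · refine fun j _ hne => Set.indicator_of_notMem (fun h => ?_) _
      rcases lt_or_gt_of_ne hne with hlt | hgt
      · exact hmin j hlt h.1
      · exact h.2 _ hgt hkz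

lemma integrable_indicator_one {α : Type*} [MeasurableSpace α] {μ : Measure α} [IsFiniteMeasure μ]
    {A : Set α} (hA : MeasurableSet A) : Integrable (A.indicator (1 : α → ℝ)) μ :=
  (integrable_const (1 : ℝ)).indicator hA

lemma real_avoids_compl {d : ℕ} (μ : Measure (Path d)) [IsFiniteMeasure μ] (z : Site d) (n : ℕ) :
    μ.real (avoids z n)ᶜ = ∑ k ∈ Finset.range n, μ.real (firstHit z k) := by
  rw [← integral_indicator_one (measurableSet_avoids z n).compl]
  simp_rw [indicator_avoids_compl]
  rw [integral_finsetSum _ fun k _ => integrable_indicator_one (measurableSet_firstHit z k)]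
  exact Finset.sum_congr rfl fun k _ => integral_indicator_one (measurableSet_firstHit z k)

/-- The `i`-th coordinate of the quenched mean, restricted to the event `A`. -/
noncomputable def coordMean {d : ℕ} (A : Set (Path d)) (n : ℕ) (i : Fin d) (ω : Env d) : ℝ :=
  ∫ X in A, (X n i : ℝ) ∂(quenchedLaw ω 0)

lemma measurable_coordMean {d : ℕ} {A : Set (Path d)} (hA : MeasurableSet A) (n : ℕ) (i : Fin d) :
    Measurable (coordMean A n i) := by
  have : coordMean A n i = fun ω : Env d =>
      ∫ X, A.indicator (fun X => (X n i : ℝ)) X ∂(quenchedKernel 0 ω) := by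
    funext ω
    exact (integral_indicator hA).symm
  rw [this]
  exact (((measurable_coord i n).indicator hA).stronglyMeasurable.integral_kernel).measurable

/-- The sites with coordinates of size at most `N`. -/
noncomputable def cube (d N : ℕ) : Finset (Site d) := Fintype.piFinset fun _ => Finset.Icc (-(N : ℤ)) N

lemma mem_cube {d N : ℕ} {x : Site d} : x ∈ cube d N ↔ ∀ i, |x i| ≤ (N : ℤ) := by
  simp [cube, abs_le]

/-- Confinement to a cube makes the mean bounded for every environment, not just almost every one,
and dependent on finitely many sites, as `IsIIDProduct.variance_le_sum` requires. -/
lemma abs_coordMean_le {d N : ℕ} {A : Set (Path d)} {n : ℕ} (hA : A ⊆ confined (cube d N) n)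
    (i : Fin d) (ω : Env d) : |coordMean A n i ω| ≤ N := by
  have h : ‖∫ X in A, (X n i : ℝ) ∂(quenchedLaw ω 0)‖ ≤ N * (quenchedLaw ω 0).real A := by
    refine norm_setIntegral_le_of_norm_le_const (measure_lt_top _ _) fun X hX => ?_
    have := mem_cube.1 (hA hX n le_rfl) i
    rw [Real.norm_eq_abs]
    exact_mod_cast this
  exact h.trans (mul_le_of_le_one_right (by positivity) measureReal_le_one)

lemma dependsOn_coordMean {d n : ℕ} {A : Set (Path d)} {H : Set (Site d)} (i : Fin d)
    (hA : DependsOn (· ∈ A) (Set.Iic n)) (hs : ∀ X ∈ A, ∀ k < n, X k ∈ H) :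
    DependsOn (coordMean A n i) H := by
  intro ω ω' h
  refine setIntegral_quenchedLaw_congr h 0 hA hs fun X Y hXY => ?_
  rw [hXY n (Set.mem_Iic.2 le_rfl)]

lemma mem_confined_of_mem_lipschitzPaths {d K n : ℕ} {X : Path d} (hX : X ∈ lipschitzPaths d K) :
    X ∈ confined (cube d (K * n)) n := by
  intro k hk
  refine mem_cube.2 fun i => ?_
  have h1 := abs_sub_le_of_mem_lipschitzPaths hX i (Nat.zero_le k)
  simp only [hX.1, Pi.zero_apply, Int.cast_zero, sub_zero, Nat.cast_zero] at h1
  have h2 : (k : ℝ) ≤ n := by exact_mod_cast hk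
  have h3 : |(X k i : ℝ)| ≤ K * n := h1.trans (by gcongr)
  exact_mod_cast h3

lemma coordMean_confined {d K n : ℕ} {ω : Env d} (hω : StepsLE K ω) (i : Fin d) (A : Set (Path d))
    (hA : MeasurableSet A) : coordMean (confined (cube d (K * n)) n ∩ A) n i ω =
      ∫ X, A.indicator (fun X => (X n i : ℝ)) X ∂(quenchedLaw ω 0) := by
  rw [coordMean, integral_indicator hA]
  refine setIntegral_congr_set ?_
  filter_upwards [ae_mem_lipschitzPaths hω] with X hX
  exact propext (and_iff_right (mem_confined_of_mem_lipschitzPaths hX))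

/-- The quenched mean in which the walk, once it hits `z`, is replaced by its conditioned mean. -/
noncomputable def blindMean {d : ℕ} (P : Measure (Env d)) (u z : Site d) (N n : ℕ) (i : Fin d)
    (ω : Env d) : ℝ :=
  coordMean (confined (cube d N) n ∩ avoids z n) n i ω +
    ∑ k ∈ Finset.range n, (z i + forwardMean P u i (n - k)) * (quenchedLaw ω 0).real (firstHit z k)

lemma measurable_blindMean {d : ℕ} (P : Measure (Env d)) (u z : Site d) (N n : ℕ) (i : Fin d) :
    Measurable (blindMean P u z N n i) :=
  (measurable_coordMean ((measurableSet_confined _ n).inter (measurableSet_avoids z n)) n i).add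
    (Finset.measurable_fun_sum _ fun k _ =>
      (measurable_quenchedLaw_real (measurableSet_firstHit z k)).const_mul _)

lemma abs_blindMean_le {d : ℕ} (P : Measure (Env d)) (u z : Site d) (N n : ℕ) (i : Fin d)
    (ω : Env d) : |blindMean P u z N n i ω| ≤
      N + ∑ k ∈ Finset.range n, |z i + forwardMean P u i (n - k)| := by
  refine (abs_add_le _ _).trans (add_le_add (abs_coordMean_le Set.inter_subset_left i ω) ?_)
  refine (Finset.abs_sum_le_sum_abs _ _).trans (Finset.sum_le_sum fun k _ => ?_)
  rw [abs_mul]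
  exact mul_le_of_le_one_right (abs_nonneg _) (abs_real_le_one _ _)

/-- Neither avoiding `z` before time `n` nor first reaching it at time `k` uses a jump out of `z`.
-/
lemma dependsOn_blindMean {d : ℕ} (P : Measure (Env d)) (u z : Site d) (N n : ℕ) (i : Fin d) :
    DependsOn (blindMean P u z N n i) {z}ᶜ := by
  intro ω ω' h
  refine congrArg₂ (· + ·) ?_ (Finset.sum_congr rfl fun k _ => ?_)
  · exact dependsOn_coordMean i (dependsOn_mem_inter (dependsOn_confined _ n)
      (dependsOn_avoids z n)) (fun X hX k hk => hX.2 k hk) h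
  · rw [measureReal_def, measureReal_def, quenchedLaw_congr h 0 (dependsOn_firstHit z k)
      fun X hX j hj => hX.2 j hj]

/-- The two means treat paths that avoid `z` alike, so only paths hitting `z` before time `n`
contribute. -/
lemma coordMean_sub_blindMean {d K n : ℕ} (P : Measure (Env d)) (u z : Site d) (i : Fin d)
    {ω : Env d} (hω : StepsLE K ω) :
    coordMean (confined (cube d (K * n)) n) n i ω - blindMean P u z (K * n) n i ω =
      ∫ X, ∑ k ∈ Finset.range n, (firstHit z k).indicator
        (fun X => (X n i : ℝ) - z i - forwardMean P u i (n - k)) X ∂(quenchedLaw ω 0) := by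
  have hl := ae_mem_lipschitzPaths hω
  have h1 : Integrable (fun X : Path d => (X n i : ℝ)) (quenchedLaw ω 0) := integrable_coord hl i n
  have h2 := h1.indicator (measurableSet_avoids z n)
  have h3 : ∀ k, Integrable (fun X => (z i + forwardMean P u i (n - k)) *
      (firstHit z k).indicator 1 X) (quenchedLaw ω 0) := fun k =>
    (integrable_indicator_one (measurableSet_firstHit z k)).const_mul _
  have h4 := coordMean_confined (n := n) hω i Set.univ MeasurableSet.univ
  rw [Set.inter_univ, Set.indicator_univ] at h4
  have h5 : Integrable (fun X => (avoids z n).indicator (fun X => (X n i : ℝ)) X +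
      ∑ k ∈ Finset.range n, (z i + forwardMean P u i (n - k)) * (firstHit z k).indicator 1 X)
      (quenchedLaw ω 0) := h2.add (integrable_finsetSum _ fun k _ => h3 k)
  rw [blindMean, h4, coordMean_confined hω i _ (measurableSet_avoids z n)]
  simp_rw [← integral_indicator_one (measurableSet_firstHit z _), ← integral_const_mul]
  rw [← integral_finsetSum _ fun k _ => h3 k, ← integral_add h2 (integrable_finsetSum _
    fun k _ => h3 k), ← integral_sub h1 h5]
  refine integral_congr_ae (Eventually.of_forall fun X => ?_)
  have hsplit : (X n i : ℝ) = (avoids z n).indicator (fun X => (X n i : ℝ)) X +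
      ∑ k ∈ Finset.range n, (X n i : ℝ) * (firstHit z k).indicator 1 X := by
    rw [← Finset.mul_sum, ← indicator_avoids_compl]
    by_cases hX : X ∈ avoids z n
    · simp [hX]
    · simp [hX]
  have hterm : ∀ k, (firstHit z k).indicator
      (fun X : Path d => (X n i : ℝ) - z i - forwardMean P u i (n - k)) X =
      (X n i : ℝ) * (firstHit z k).indicator 1 X -
        (z i + forwardMean P u i (n - k)) * (firstHit z k).indicator 1 X := fun k => by
    by_cases hX : X ∈ firstHit z k
    · simp only [Set.indicator_of_mem hX, Pi.one_apply]
      ring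
    · simp [hX]
  simp_rw [hterm]
  rw [Finset.sum_sub_distrib]
  linarith

/-! ### The mean-square influence of one site -/

lemma IsIIDProduct.ae_stepsLE_merge {d K : ℕ} {P : Measure (Env d)} (hP : IsIIDProduct P)
    (hK : ∀ᵐ ω ∂P, StepsLE K ω) (T : Set (Site d)) :
    ∀ᵐ ω ∂P, ∀ᵐ ω' ∂P, StepsLE K (merge T ω ω') :=
  have := hP.isProbabilityMeasure
  Measure.ae_ae_of_ae_prod ((hP.measurePreserving_merge T).quasiMeasurePreserving.ae hK)

lemma IsIIDProduct.abs_partialMean_sub_le {d K n : ℕ} {P : Measure (Env d)} (hP : IsIIDProduct P)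
    (hK : ∀ᵐ ω ∂P, StepsLE K ω) {u z : Site d} {T : Set (Site d)}
    (hT : ∀ x ∈ T, x ⬝ᵥ u ≤ z ⬝ᵥ u) {ω : Env d} (hω : ∀ᵐ ω' ∂P, StepsLE K (merge T ω ω'))
    (ℓ : ℕ) (i : Fin d) :
    |partialMean P T (coordMean (confined (cube d (K * n)) n) n i) ω -
      partialMean P T (blindMean P u z (K * n) n i) ω| ≤
    2 * K * (ℓ * (partialLaw P T ω).real (avoids z n)ᶜ + n * ∑ k ∈ Finset.range n,
      (partialLaw P T ω).real (firstHit z k ∩ noRegeneration u k ℓ)) := by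
  have := hP.isProbabilityMeasure
  have hl : ∀ᵐ X ∂(partialLaw P T ω), X ∈ lipschitzPaths d K :=
    ae_averagedLaw_lipschitz (ae_map_stepsLE hω)
  have hm : ∀ k, Measurable ((firstHit z k).indicator
      fun X : Path d => (X n i : ℝ) - z i - forwardMean P u i (n - k)) := fun k =>
    (((measurable_coord i n).sub_const _).sub_const _).indicator (measurableSet_firstHit z k)
  have hi : ∀ k, Integrable ((firstHit z k).indicator
      fun X : Path d => (X n i : ℝ) - z i - forwardMean P u i (n - k)) (partialLaw P T ω) :=
    fun k => (((integrable_coord hl i n).sub (integrable_const _)).sub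
      (integrable_const _)).indicator (measurableSet_firstHit z k)
  have heq : partialMean P T (coordMean (confined (cube d (K * n)) n) n i) ω -
      partialMean P T (blindMean P u z (K * n) n i) ω = ∑ k ∈ Finset.range n,
      ∫ X in firstHit z k, ((X n i : ℝ) - z i - forwardMean P u i (n - k))
        ∂(partialLaw P T ω) := by
    simp_rw [← integral_indicator (measurableSet_firstHit z _)]
    rw [← integral_finsetSum _ fun k _ => hi k, integral_partialLaw P T ω
      (Finset.measurable_fun_sum _ fun k _ => hm k) (integrable_finsetSum _ fun k _ => hi k),
      partialMean, partialMean, ← integral_sub]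
    · refine integral_congr_ae ?_
      filter_upwards [hω] with ω' hω' using coordMean_sub_blindMean P u z i hω'
    · exact integrable_of_abs_le ((measurable_coordMean (measurableSet_confined _ n) n i).comp
        (measurable_merge_right T ω)) fun ω' => abs_coordMean_le subset_rfl i _
    · exact integrable_of_abs_le ((measurable_blindMean P u z _ n i).comp
        (measurable_merge_right T ω)) fun ω' => abs_blindMean_le P u z _ n i _
  rw [heq, real_avoids_compl, Finset.mul_sum, Finset.mul_sum, ← Finset.sum_add_distrib,
    Finset.mul_sum]
  refine (Finset.abs_sum_le_sum_abs _ _).trans (Finset.sum_le_sum fun k hk => ?_)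
  exact hP.abs_setIntegral_firstHit_le hK hT hω (Finset.mem_range.1 hk).le ℓ i

/-- The hitting probability stays squared, for comparison with two walks; averaging over part of the
environment contracts `L²`, so it may be replaced by its quenched version. The long-gap probability
is kept to first power, so its integral is an averaged probability. -/
lemma IsIIDProduct.integral_sq_partialMean_sub_blindMean_le {d K n : ℕ} {P : Measure (Env d)}
    (hP : IsIIDProduct P) (hK : ∀ᵐ ω ∂P, StepsLE K ω) {u z : Site d} {T : Set (Site d)}
    (hT : ∀ x ∈ T, x ⬝ᵥ u ≤ z ⬝ᵥ u) (ℓ : ℕ) (i : Fin d) :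
    ∫ ω, (partialMean P T (coordMean (confined (cube d (K * n)) n) n i) ω -
      partialMean P T (blindMean P u z (K * n) n i) ω) ^ 2 ∂P ≤
    8 * K ^ 2 * (ℓ ^ 2 * ∫ ω, (quenchedLaw ω 0).real (avoids z n)ᶜ ^ 2 ∂P +
      n ^ 2 * ∑ k ∈ Finset.range n,
        (averagedLaw P 0).real (firstHit z k ∩ noRegeneration u k ℓ)) := by
  have := hP.isProbabilityMeasure
  have hAm := (measurableSet_avoids z n).compl
  have hGm := fun k => (measurableSet_firstHit z k).inter (measurableSet_noRegeneration u k ℓ)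
  set V : Env d → ℝ := partialMean P T fun ω => (quenchedLaw ω 0).real (avoids z n)ᶜ with hV
  set W : ℕ → Env d → ℝ := fun k => partialMean P T fun ω =>
    (quenchedLaw ω 0).real (firstHit z k ∩ noRegeneration u k ℓ) with hW
  have hVm : Measurable V := measurable_partialMean P T (measurable_quenchedLaw_real hAm)
  have hWm : ∀ k, Measurable (W k) := fun k =>
    measurable_partialMean P T (measurable_quenchedLaw_real (hGm k))
  have hVb : ∀ ω, |V ω| ≤ 1 := abs_partialMean_le P T fun ω => abs_real_le_one _ _
  have hWb : ∀ k ω, |W k ω| ≤ 1 := fun k => abs_partialMean_le P T fun ω => abs_real_le_one _ _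
  have hV2 : Integrable (fun ω => V ω ^ 2) P := integrable_sq_of_abs_le hVm hVb
  have hWi : ∀ k, Integrable (W k) P := fun k => integrable_of_abs_le (hWm k) (hWb k)
  have hWs : Integrable (fun ω => ∑ k ∈ Finset.range n, W k ω) P :=
    integrable_finsetSum _ fun k _ => hWi k
  have hpt : ∀ᵐ ω ∂P, (partialMean P T (coordMean (confined (cube d (K * n)) n) n i) ω -
      partialMean P T (blindMean P u z (K * n) n i) ω) ^ 2 ≤
      8 * K ^ 2 * (ℓ ^ 2 * V ω ^ 2 + n ^ 2 * ∑ k ∈ Finset.range n, W k ω) := by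
    filter_upwards [hP.ae_stepsLE_merge hK T] with ω hω
    have h1 := hP.abs_partialMean_sub_le (n := n) hK hT hω ℓ i
    have hVω : V ω = (partialLaw P T ω).real (avoids z n)ᶜ := (partialLaw_real P T ω hAm).symm
    have hWω : ∀ k, W k ω = (partialLaw P T ω).real (firstHit z k ∩ noRegeneration u k ℓ) :=
      fun k => (partialLaw_real P T ω (hGm k)).symm
    simp_rw [← hVω, ← hWω] at h1
    set w := ∑ k ∈ Finset.range n, W k ω
    have hw0 : 0 ≤ w := Finset.sum_nonneg fun k _ => by
      rw [hWω]
      exact measureReal_nonneg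
    -- Distinct first hitting times are disjoint events, so `w` is at most a probability and `w ^ 2
    -- ≤ w`.
    have hw1 : w ≤ 1 := by
      refine le_trans ?_ (measureReal_le_one (μ := partialLaw P T ω) (s := (avoids z n)ᶜ))
      rw [real_avoids_compl]
      refine Finset.sum_le_sum fun k _ => ?_
      rw [hWω]
      exact measureReal_mono Set.inter_subset_left
    refine (sq_le_sq' (abs_le.1 h1).1 (abs_le.1 h1).2).trans ?_
    have h2 : ((ℓ : ℝ) * V ω + n * w) ^ 2 ≤ 2 * (ℓ ^ 2 * V ω ^ 2 + n ^ 2 * w) := by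
      have h3 := add_sq_le (a := (ℓ : ℝ) * V ω) (b := n * w)
      have h4 : (n : ℝ) ^ 2 * w ^ 2 ≤ n ^ 2 * w := by
        refine mul_le_mul_of_nonneg_left ?_ (by positivity)
        nlinarith
      rw [mul_pow, mul_pow] at h3
      linarith
    calc (2 * K * (ℓ * V ω + n * w)) ^ 2 = 4 * (K : ℝ) ^ 2 * (ℓ * V ω + n * w) ^ 2 := by ring
      _ ≤ 4 * (K : ℝ) ^ 2 * (2 * (ℓ ^ 2 * V ω ^ 2 + n ^ 2 * w)) := by gcongr
      _ = 8 * K ^ 2 * (ℓ ^ 2 * V ω ^ 2 + n ^ 2 * w) := by ring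
  have hint : Integrable (fun ω => 8 * (K : ℝ) ^ 2 *
      (ℓ ^ 2 * V ω ^ 2 + n ^ 2 * ∑ k ∈ Finset.range n, W k ω)) P :=
    ((hV2.const_mul _).add (hWs.const_mul _)).const_mul _
  refine (integral_mono_of_nonneg (Eventually.of_forall fun ω => sq_nonneg _) hint hpt).trans ?_
  rw [integral_const_mul, integral_add (hV2.const_mul _) (hWs.const_mul _), integral_const_mul,
    integral_const_mul, integral_finsetSum _ fun k _ => hWi k]
  have hV' := hP.integral_sq_partialMean_le T (measurable_quenchedLaw_real hAm)
    fun ω => abs_real_le_one _ _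
  have hW' : ∀ k, ∫ ω, W k ω ∂P =
      (averagedLaw P 0).real (firstHit z k ∩ noRegeneration u k ℓ) := fun k => by
    rw [averagedLaw_real _ (hGm k)]
    exact hP.integral_partialMean T (measurable_quenchedLaw_real (hGm k))
      fun ω => abs_real_le_one _ _
  simp_rw [hW']
  gcongr

/-! ### Summing over the sites -/

/-- The walk occupies one site at time `k`, so summing over `z` costs no volume factor. -/
lemma sum_real_firstHit_inter_le {d : ℕ} (μ : Measure (Path d)) [IsFiniteMeasure μ]
    (B : Finset (Site d)) (k : ℕ) {G : Set (Path d)} (hG : MeasurableSet G) :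
    ∑ z ∈ B, μ.real (firstHit z k ∩ G) ≤ μ.real G := by
  rw [← measureReal_biUnion_finset (fun z _ z' _ hne => Set.disjoint_left.2 fun X hX hX' =>
    hne (hX.1.1.symm.trans hX'.1.1)) fun z _ => (measurableSet_firstHit z k).inter hG]
  exact measureReal_mono (Set.iUnion₂_subset fun z _ => Set.inter_subset_right)

lemma visited_finite {d : ℕ} (X : Path d) (n : ℕ) : (visited X n).Finite :=
  ((Set.finite_Iio n).image X).subset fun _ ⟨k, hk, h⟩ => ⟨k, hk, h⟩

lemma ncard_visited_le {d : ℕ} (X : Path d) (n : ℕ) : (visited X n).ncard ≤ n := by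
  have h : visited X n = X '' (Finset.range n : Set ℕ) := by
    ext x
    simp [visited]
  rw [h]
  refine (Set.ncard_image_le (Finset.finite_toSet _)).trans ?_
  rw [Set.ncard_coe_finset, Finset.card_range]

lemma measurable_ncard_inter {d : ℕ} (n : ℕ) : Measurable fun p : Path d × Path d =>
    ((visited p.1 n ∩ visited p.2 n).ncard : ℝ) := by
  have h : (fun p : Path d × Path d => ((visited p.1 n ∩ visited p.2 n).ncard : ℝ)) =
      (fun q : (Fin (n + 1) → Site d) × (Fin (n + 1) → Site d) =>
        ((visited (extend q.1) n ∩ visited (extend q.2) n).ncard : ℝ)) ∘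
      Prod.map (initial n) (initial n) := by
    have hv : ∀ X : Path d, visited (extend (initial n X)) n = visited X n := fun X => by
      ext x
      simp only [visited, Set.mem_ofPred_eq]
      refine exists_congr fun k => and_congr_right fun hk => ?_
      rw [extend_initial X hk.le]
    funext p
    simp [hv]
  rw [h]
  exact (measurable_of_countable _).comp ((measurable_initial n).prodMap (measurable_initial n))

/-- Given `ω`, the squared hitting probability is the probability that both walks visit `z`; summing
over `B` counts their common sites in `B`. -/
lemma sum_integral_sq_le_expectedIntersections {d : ℕ} (P : Measure (Env d))
    [IsProbabilityMeasure P] (B : Finset (Site d)) (n : ℕ) :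
    ∑ z ∈ B, ∫ ω, (quenchedLaw ω 0).real (avoids z n)ᶜ ^ 2 ∂P ≤ expectedIntersections P n := by
  have hmem : ∀ (z : Site d) (X : Path d), X ∈ (avoids z n)ᶜ ↔ z ∈ visited X n := fun z X => by
    simp [avoids, visited]
  have hbound : ∀ p : Path d × Path d,
      |((visited p.1 n ∩ visited p.2 n).ncard : ℝ)| ≤ n := fun p => by
    rw [Nat.abs_cast]
    exact_mod_cast (Set.ncard_le_ncard Set.inter_subset_left (visited_finite p.1 n)).trans
      (ncard_visited_le p.1 n)
  have hi := fun (μ : Measure (Path d × Path d)) (_ : IsFiniteMeasure μ) =>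
    integrable_of_abs_le (μ := μ) (measurable_ncard_inter n) hbound
  have hprob : IsProbabilityMeasure (averagedPairLaw P 0 0) :=
    inferInstanceAs (IsProbabilityMeasure (P.bind (quenchedKernel 0 ×ₖ quenchedKernel 0)))
  have hfin : IsFiniteMeasure (averagedPairLaw P 0 0) := inferInstance
  rw [expectedIntersections, averagedPairLaw, integral_bind_kernel (hi _ hfin),
    ← integral_finsetSum]
  · refine integral_mono_of_nonneg (Eventually.of_forall fun ω => Finset.sum_nonneg fun z _ =>
      sq_nonneg _) ?_ (Eventually.of_forall fun ω => ?_)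
    · exact integrable_of_abs_le
        ((measurable_ncard_inter n).stronglyMeasurable.integral_kernel).measurable fun ω => by
          have := norm_integral_le_of_norm_le_const
            (μ := (quenchedKernel (d := d) 0 ×ₖ quenchedKernel 0) ω)
            (f := fun p => ((visited p.1 n ∩ visited p.2 n).ncard : ℝ))
            (Eventually.of_forall hbound)
          simpa using this
    · simp only [Kernel.prod_apply]
      change _ ≤ ∫ p, _ ∂((quenchedLaw ω 0).prod (quenchedLaw ω 0))
      have hsq : ∀ z, (quenchedLaw ω 0).real (avoids z n)ᶜ ^ 2 =
          ∫ p, ((avoids z n)ᶜ ×ˢ (avoids z n)ᶜ).indicator (1 : Path d × Path d → ℝ) p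
            ∂((quenchedLaw ω 0).prod (quenchedLaw ω 0)) := fun z => by
        rw [integral_indicator_one ((measurableSet_avoids z n).compl.prod
          (measurableSet_avoids z n).compl), measureReal_prod_prod, pow_two]
      have hiz : ∀ z, Integrable
          (((avoids z n)ᶜ ×ˢ (avoids z n)ᶜ).indicator (1 : Path d × Path d → ℝ))
            ((quenchedLaw ω 0).prod (quenchedLaw ω 0)) := fun z => integrable_indicator_one
        ((measurableSet_avoids z n).compl.prod (measurableSet_avoids z n).compl)
      simp_rw [hsq]
      rw [← integral_finsetSum _ fun z _ => hiz z]
      refine integral_mono (integrable_finsetSum _ fun z _ => hiz z) (hi _ inferInstance)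
        fun p => ?_
      classical
      have hfin : (visited p.1 n ∩ visited p.2 n).Finite := (visited_finite p.1 n).inter_of_left _
      have hterm : ∀ z, ((avoids z n)ᶜ ×ˢ (avoids z n)ᶜ).indicator (1 : Path d × Path d → ℝ) p =
          if z ∈ visited p.1 n ∩ visited p.2 n then 1 else 0 := fun z => by
        simp only [Set.indicator_apply, Set.mem_prod, hmem, Set.mem_inter_iff, Pi.one_apply]
      simp only [hterm]
      rw [Finset.sum_boole, Nat.cast_le, Set.ncard_eq_toFinset_card _ hfin]
      exact Finset.card_le_card fun z hz => hfin.mem_toFinset.2 (Finset.mem_filter.1 hz).2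
  · intro z _
    exact integrable_sq_of_abs_le
      (measurable_quenchedLaw_real (measurableSet_avoids z n).compl) fun ω => abs_real_le_one _ _

/-- Both walks visit the origin at time `0`. This bound absorbs additive constants in the final
estimate without any assumption on the sign of `α`. -/
lemma one_le_expectedIntersections {d : ℕ} (P : Measure (Env d)) [IsProbabilityMeasure P] {n : ℕ}
    (hn : 1 ≤ n) : 1 ≤ expectedIntersections P n := by
  refine le_trans (le_of_eq ?_) (sum_integral_sq_le_expectedIntersections P {0} n)
  have h : ∀ ω : Env d, (quenchedLaw ω 0).real (avoids 0 n)ᶜ = 1 := fun ω => by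
    have h1 : quenchedLaw ω 0 (cyl 0 0) = 1 := by
      rw [quenchedLaw_cyl]
      simp
    have h2 : cyl 0 0 ⊆ (avoids (0 : Site d) n)ᶜ := fun X hX h =>
      h 0 (by omega) (hX 0 le_rfl)
    rw [measureReal_def, le_antisymm prob_le_one (h1.ge.trans (measure_mono h2)),
      ENNReal.toReal_one]
  simp [h]

lemma IsIIDProduct.variance_coordMean_le {d K n : ℕ} {P : Measure (Env d)} (hP : IsIIDProduct P)
    (hK : ∀ᵐ ω ∂P, StepsLE K ω) (u : Site d) (ℓ : ℕ) (i : Fin d) :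
    ∫ ω, (coordMean (confined (cube d (K * n)) n) n i ω -
      ∫ ω', coordMean (confined (cube d (K * n)) n) n i ω' ∂P) ^ 2 ∂P ≤
    8 * K ^ 2 * (ℓ ^ 2 * expectedIntersections P n +
      n ^ 4 * (averagedLaw P 0).real (noRegeneration u 0 ℓ)) := by
  have := hP.isProbabilityMeasure
  refine (hP.variance_le_sum u (measurable_coordMean (measurableSet_confined _ n) n i)
    (abs_coordMean_le subset_rfl i) (dependsOn_coordMean i (dependsOn_confined _ n)
      fun X hX k hk => hX k hk.le) fun z S hS => ⟨partialMean P (insert z S)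
      (blindMean P u z (K * n) n i), measurable_partialMean P _ (measurable_blindMean P u z _ n i),
      ⟨_, abs_partialMean_le P _ (abs_blindMean_le P u z _ n i)⟩,
      dependsOn_partialMean P (dependsOn_blindMean P u z _ n i) ?_,
      hP.integral_sq_partialMean_sub_blindMean_le hK ?_ ℓ i⟩).trans ?_
  -- Removing `z` from `insert z S` leaves only sites of `S`, so the conditioned `blindMean` is an
  -- admissible predictor.
  · rintro x ⟨hx, hxz⟩
    exact (Set.mem_insert_iff.1 hx).resolve_left hxz
  · exact Set.forall_mem_insert.2 ⟨le_rfl, hS⟩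
  · rw [← Finset.mul_sum, Finset.sum_add_distrib, ← Finset.mul_sum, ← Finset.mul_sum,
      Finset.sum_comm]
    gcongr ?_ * (?_ * ?_ + ?_)
    · exact sum_integral_sq_le_expectedIntersections P _ n
    -- Each `k < n` contributes a factor `k + 1 ≤ n`. With the `n` values of `k` and the existing `n
    -- ^ 2`, this gives `n ^ 4`.
    · have hgap : ∀ k ∈ Finset.range n, ∑ z ∈ cube d (K * n),
          (averagedLaw P 0).real (firstHit z k ∩ noRegeneration u k ℓ) ≤
          n * (averagedLaw P 0).real (noRegeneration u 0 ℓ) := fun k hk => by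
        refine (sum_real_firstHit_inter_le _ _ k (measurableSet_noRegeneration u k ℓ)).trans ?_
        have h1 := ENNReal.toReal_mono (ENNReal.mul_ne_top (ENNReal.natCast_ne_top _)
          (measure_ne_top _ _)) (hP.averagedLaw_noRegeneration_le u k ℓ)
        rw [ENNReal.toReal_mul, ENNReal.toReal_natCast] at h1
        refine h1.trans ?_
        gcongr
        · exact Finset.mem_range.1 hk
        · exact le_rfl
      refine (mul_le_mul_of_nonneg_left (Finset.sum_le_card_nsmul _ _ _ hgap)
        (by positivity)).trans (le_of_eq ?_)
      rw [Finset.card_range, nsmul_eq_mul]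
      ring

lemma IsIIDProduct.quenchedMeanVariance_le {d K : ℕ} {P : Measure (Env d)} (hP : IsIIDProduct P)
    (hK : ∀ᵐ ω ∂P, StepsLE K ω) (u : Site d) (ℓ n : ℕ) :
    quenchedMeanVariance P n ≤ d * (8 * K ^ 2 * (ℓ ^ 2 * expectedIntersections P n +
      n ^ 4 * (averagedLaw P 0).real (noRegeneration u 0 ℓ))) := by
  have := hP.isProbabilityMeasure
  set f : Fin d → Env d → ℝ := coordMean (confined (cube d (K * n)) n) n with hf
  have hfm : ∀ i, Measurable (f i) := measurable_coordMean (measurableSet_confined _ n) n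
  have hfb : ∀ i ω, |f i ω| ≤ (K * n : ℕ) := abs_coordMean_le subset_rfl
  have hq : ∀ ω, StepsLE K ω → ∀ i, quenchedMean ω n i = f i ω := fun ω hω i => by
    have h4 := coordMean_confined (n := n) hω i Set.univ MeasurableSet.univ
    rw [Set.inter_univ, Set.indicator_univ] at h4
    rw [hf, h4, quenchedMean, eval_integral_piLp fun i =>
      integrable_coord (ae_mem_lipschitzPaths hω) i n]
    rfl
  have ha : ∀ i, averagedMean P n i = ∫ ω, f i ω ∂P := fun i => by
    have hint := fun i => integrable_coord (ae_averagedLaw_lipschitz hK) i n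
    rw [averagedMean, eval_integral_piLp hint]
    refine (integral_bind_kernel (hint i)).trans (integral_congr_ae ?_)
    filter_upwards [hK] with ω hω
    rw [← hq ω hω, quenchedMean, eval_integral_piLp fun i =>
      integrable_coord (ae_mem_lipschitzPaths hω) i n]
    rfl
  have hnorm : quenchedMeanVariance P n = ∑ i, ∫ ω, (f i ω - ∫ ω', f i ω' ∂P) ^ 2 ∂P := by
    rw [quenchedMeanVariance, ← integral_finsetSum]
    · refine integral_congr_ae ?_
      filter_upwards [hK] with ω hω
      rw [EuclideanSpace.real_norm_sq_eq]
      refine Finset.sum_congr rfl fun i _ => ?_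
      rw [PiLp.sub_apply, hq ω hω, ha]
    · intro i _
      have hb : ∀ ω, |f i ω - ∫ ω', f i ω' ∂P| ≤ (K * n : ℕ) + |∫ ω', f i ω' ∂P| := fun ω =>
        (abs_sub _ _).trans (add_le_add_left (hfb i ω) _)
      exact integrable_sq_of_abs_le ((hfm i).sub_const _) hb
  rw [hnorm]
  refine (Finset.sum_le_card_nsmul _ _ _ fun i _ =>
    hP.variance_coordMean_le (n := n) hK u ℓ i).trans (le_of_eq ?_)
  simp

/-- Since `ε * p ≥ 4`, the factor `n ^ 4` is at most `ℓ ^ p`, which the moment of `τ_1` absorbs. -/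
lemma pow_mul_real_noRegeneration_le {d : ℕ} {P : Measure (Env d)} [IsProbabilityMeasure P]
    {u : Site d} {p ε : ℝ} (hT : regenerationMoment P u p < ⊤) (hp : 0 ≤ p) (hεp : 4 ≤ ε * p)
    {n ℓ : ℕ} (hn : 1 ≤ n) (hℓ : (n : ℝ) ^ ε ≤ ℓ) :
    (n : ℝ) ^ 4 * (averagedLaw P 0).real (noRegeneration u 0 ℓ) ≤
      (regenerationMoment P u p).toReal := by
  have h1 := ENNReal.toReal_mono hT.ne (averagedLaw_noRegeneration_mul_le P u hp ℓ)
  rw [ENNReal.toReal_mul, ← ENNReal.toReal_rpow, ENNReal.toReal_natCast] at h1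
  have hn' : (1 : ℝ) ≤ n := by exact_mod_cast hn
  have h2 : (n : ℝ) ^ 4 ≤ (ℓ : ℝ) ^ p := calc
    (n : ℝ) ^ 4 = (n : ℝ) ^ (4 : ℝ) := by norm_cast
    _ ≤ (n : ℝ) ^ (ε * p) := Real.rpow_le_rpow_of_exponent_le hn' hεp
    _ = ((n : ℝ) ^ ε) ^ p := Real.rpow_mul (by positivity) _ _
    _ ≤ (ℓ : ℝ) ^ p := Real.rpow_le_rpow (by positivity) hℓ hp
  refine (mul_le_mul_of_nonneg_right h2 measureReal_nonneg).trans ?_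
  rw [mul_comm]
  exact h1

end RWRE

/-! ### Choice of the gap length and the final rate -/

theorem proposition6p1 {d : ℕ} (hd : 1 ≤ d) (P : Measure (RWRE.Env d))
    (hP : RWRE.IsIIDProduct P) (u : RWRE.Site d) (hu : RWRE.IsTransient P u)
    (p₀ : ℝ) (hT : RWRE.regenerationMoment P u p₀ < ⊤) (hS : RWRE.HasBoundedSteps P)
    (αbar : ℝ) (hαbar : αbar < 1 / 2)
    (hinter : RWRE.expectedIntersections P =O[atTop] fun n : ℕ => (n : ℝ) ^ (2 * αbar))
    (α : ℝ) (hα : α ∈ Set.Ioo αbar (1 / 2)) (hp₀ : 22 * (d : ℝ) / (α - αbar) < p₀) :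
    RWRE.quenchedMeanVariance P =O[atTop] fun n : ℕ => (n : ℝ) ^ (2 * α) := by
  have := hP.isProbabilityMeasure
  obtain ⟨K, hK⟩ := hP.exists_stepsLE hS
  have hε : 0 < α - αbar := sub_pos.2 hα.1
  have hd' : (1 : ℝ) ≤ d := by exact_mod_cast hd
  have hεp : 22 * (d : ℝ) < (α - αbar) * p₀ := by
    rw [mul_comm (α - αbar)]
    exact (div_lt_iff₀ hε).1 hp₀
  have hp : 0 ≤ p₀ := by
    by_contra! h
    nlinarith
  obtain ⟨C, hC0, hC⟩ := hinter.exists_pos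
  rw [Asymptotics.IsBigOWith] at hC
  set R := (RWRE.regenerationMoment P u p₀).toReal with hR
  have hR0 : 0 ≤ R := ENNReal.toReal_nonneg
  refine Asymptotics.IsBigO.of_bound (d * (8 * K ^ 2 * ((1 + R) * (4 * C)))) ?_
  filter_upwards [hC, eventually_ge_atTop 1] with n hn hn1
  have hn' : (1 : ℝ) ≤ n := by exact_mod_cast hn1
  have hI1 : 1 ≤ RWRE.expectedIntersections P n := RWRE.one_le_expectedIntersections P hn1
  have hpow1 : (1 : ℝ) ≤ (n : ℝ) ^ (α - αbar) := Real.one_le_rpow hn' hε.le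
  -- This gap length makes `ℓ ^ 2 * n ^ (2 * αbar)` of order `n ^ (2 * α)`.
  set ℓ := ⌈(n : ℝ) ^ (α - αbar)⌉₊ with hℓ
  have hℓ1 : (n : ℝ) ^ (α - αbar) ≤ ℓ := Nat.le_ceil _
  have hℓ2 : (ℓ : ℝ) ≤ 2 * (n : ℝ) ^ (α - αbar) := by
    have := Nat.ceil_lt_add_one (zero_le_one.trans hpow1)
    linarith
  -- The exponent condition `4 ≤ (α - αbar) * p₀` follows from `22 * d < (α - αbar) * p₀` and `1 ≤
  -- d`.
  have htail := RWRE.pow_mul_real_noRegeneration_le hT hp (by linarith) hn1 hℓ1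
  have hvar := hP.quenchedMeanVariance_le hK u ℓ n
  have hV0 : 0 ≤ RWRE.quenchedMeanVariance P n := integral_nonneg fun ω => sq_nonneg _
  rw [Real.norm_of_nonneg (by linarith), Real.norm_of_nonneg (by positivity)] at hn
  rw [Real.norm_of_nonneg hV0, Real.norm_of_nonneg (by positivity)]
  have hsq1 : (1 : ℝ) ≤ (ℓ : ℝ) ^ 2 := one_le_pow₀ (hpow1.trans hℓ1)
  have hmain : (ℓ : ℝ) ^ 2 * RWRE.expectedIntersections P n ≤ 4 * C * (n : ℝ) ^ (2 * α) := calc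
    (ℓ : ℝ) ^ 2 * RWRE.expectedIntersections P n ≤
        (2 * (n : ℝ) ^ (α - αbar)) ^ 2 * (C * (n : ℝ) ^ (2 * αbar)) := by gcongr
    _ = 4 * C * ((n : ℝ) ^ (α - αbar) * (n : ℝ) ^ (α - αbar) * (n : ℝ) ^ (2 * αbar)) := by ring
    _ = 4 * C * (n : ℝ) ^ (2 * α) := by
      rw [← Real.rpow_add (by linarith), ← Real.rpow_add (by linarith)]
      ring_nf
  have hone : 1 ≤ (ℓ : ℝ) ^ 2 * RWRE.expectedIntersections P n :=
    one_le_mul_of_one_le_of_one_le hsq1 hI1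
  have hsum : (ℓ : ℝ) ^ 2 * RWRE.expectedIntersections P n +
      n ^ 4 * (RWRE.averagedLaw P 0).real (RWRE.noRegeneration u 0 ℓ) ≤
      (1 + R) * (4 * C * (n : ℝ) ^ (2 * α)) := by
    -- The bounded tail term is absorbed into the intersection term, which is at least `1`.
    have : R ≤ R * ((ℓ : ℝ) ^ 2 * RWRE.expectedIntersections P n) :=
      le_mul_of_one_le_right hR0 hone
    have h2 : (1 + R) * ((ℓ : ℝ) ^ 2 * RWRE.expectedIntersections P n) ≤
        (1 + R) * (4 * C * (n : ℝ) ^ (2 * α)) := by gcongr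
    linarith
  calc RWRE.quenchedMeanVariance P n ≤ _ := hvar
    _ ≤ d * (8 * K ^ 2 * ((1 + R) * (4 * C * (n : ℝ) ^ (2 * α)))) := by gcongr
    _ = d * (8 * K ^ 2 * ((1 + R) * (4 * C))) * (n : ℝ) ^ (2 * α) := by ring
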